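/- Let $X$ be a connected complex surface and let $w\in H^0(X,S^2\Omega^1_X)$ be a holomorphic symmetric 2-differential of rank 2, i.e. at a general point $x$ (a point outside some proper analytic subset of $X$) $w(x)$ is a product of two linearly independent covectors. A holomorphic closed decomposition of $w$ at $x$ is an expression $w=\mu_1\mu_2$ on a neighborhood of $x$ with $\mu_1,\mu_2$ closed holomorphic 1-forms. The differential $w$ is closed if it has a holomorphic closed decomposition at a general point of $X$, and it is of the 1st kind on an open set $U\subset X$ if it has one at every $x\in U$. In a holomorphic chart $(z_1,z_2)$ write $w=E\,dz_1^2+2F\,dz_1dz_2+G\,dz_2^2$, let $\operatorname{Disc}_w$ be the divisor of zeros of the section of $2K_X$ given in each chart by $EG-F^2$, and let $\operatorname{Disc}^0_w=\operatorname{Disc}_w-2(w)_0$ be the core discriminant divisor, where $(w)_0$ is the divisor of zeros of $w$ (locally given by the greatest common divisor of $E,F,G$). Let $K_{\mathbb C}(w)$ be the meromorphic function on $X$, with poles at most along $\operatorname{Disc}_w$, given in each chart by Brioschi's formula $$K_{\mathbb C}(w)=\frac{1}{(EG-F^2)^2}\left(\begin{vmatrix}-\tfrac12E_{22}+F_{12}-\tfrac12G_{11}&\tfrac12E_1&F_1-\tfrac12E_2\\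 F_2-\tfrac12G_1&E&F\\ \tfrac12G_2&F&G\end{vmatrix}-\begin{vmatrix}0&\tfrac12E_2&\tfrac12G_1\\ \tfrac12E_2&E&F\\ \tfrac12G_1&F&G\end{vmatrix}\right),$$ where the subscripts $1,2$ of $E,F,G$ denote complex partial derivatives with respect to $z_1,z_2$. Then $w$ is closed if and only if $K_{\mathbb C}(w)=0$. Moreover, $K_{\mathbb C}(w)=0$ if and only if $w$ is of the 1st kind on $X\setminus\operatorname{Supp}(\operatorname{Disc}^0_w)$. -/

import Mathlib

open scoped Manifold ContDiff Topology

noncomputable section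

namespace ClosedDiff

/-- The model with corners of complex surfaces. A complex surface is a space `X` charted on `ℂ × ℂ`
with `IsManifold surfaceModel ω X`, i.e. with holomorphic (complex analytic) transition maps. -/
abbrev surfaceModel : ModelWithCorners ℂ (ℂ × ℂ) (ℂ × ℂ) := 𝓘(ℂ, ℂ × ℂ)

section

variable {X : Type*} [TopologicalSpace X] [ChartedSpace (ℂ × ℂ) X]

/-- The holomorphic charts of `X`. -/
abbrev HolChart (e : OpenPartialHomeomorph X (ℂ × ℂ)) : Prop :=
  e ∈ IsManifold.maximalAtlas surfaceModel ω X

/-- The tangent vector `v₁ ∂/∂z₁ + v₂ ∂/∂z₂` at the point with coordinates `z` in the chart `e`. -/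
def chartVec (e : OpenPartialHomeomorph X (ℂ × ℂ)) (z v : ℂ × ℂ) :
    TangentSpace surfaceModel (e.symm z) :=
  mfderiv surfaceModel surfaceModel e.symm z v

/-- The partial derivative `∂f/∂z₁`. -/
def partial₁ (f : ℂ × ℂ → ℂ) (z : ℂ × ℂ) : ℂ := fderiv ℂ f z (1, 0)

/-- The partial derivative `∂f/∂z₂`. -/
def partial₂ (f : ℂ × ℂ → ℂ) (z : ℂ × ℂ) : ℂ := fderiv ℂ f z (0, 1)

/-! ### Holomorphic functions, analytic subsets, general points -/

/-- `f` is holomorphic on the set `U` (used for open `U`). -/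
def HolFunOn (f : X → ℂ) (U : Set X) : Prop :=
  ContMDiffOn surfaceModel 𝓘(ℂ, ℂ) ω f U

/-- Analytic subsets: locally the common zero locus of finitely many holomorphic functions. -/
def IsAnalyticSubset (Z : Set X) : Prop :=
  ∀ x : X, ∃ U : Set X, IsOpen U ∧ x ∈ U ∧ ∃ (n : ℕ) (f : Fin n → X → ℂ),
    (∀ i, HolFunOn (f i) U) ∧ ∀ y ∈ U, (y ∈ Z ↔ ∀ i, f i y = 0)

/-- `P` holds at a general point of (the connected manifold) `X`:
it holds outside a proper analytic subset. -/
def AtGeneralPoint (P : X → Prop) : Prop :=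
  ∃ Z : Set X, IsAnalyticSubset Z ∧ Z ≠ Set.univ ∧ ∀ x, x ∉ Z → P x

end

/-! ### Holomorphic 1-forms -/

section

variable (X : Type*) [TopologicalSpace X] [ChartedSpace (ℂ × ℂ) X]

/-- A (not necessarily continuous) field of covectors of type `(1,0)`. -/
abbrev CovectorField : Type _ := ∀ x : X, Module.Dual ℂ (TangentSpace surfaceModel x)

/-- A (not necessarily continuous) field of quadratic forms on the tangent spaces,
i.e. a section of `S²` of the cotangent bundle. -/
abbrev QuadraticField : Type _ := ∀ x : X, QuadraticForm ℂ (TangentSpace surfaceModel x)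

end

section

variable {X : Type*} [TopologicalSpace X] [ChartedSpace (ℂ × ℂ) X]

/-- The coefficient of `dz₁` of a 1-form in the chart `e`. -/
def coeff₁ (μ : CovectorField X) (e : OpenPartialHomeomorph X (ℂ × ℂ)) (z : ℂ × ℂ) : ℂ :=
  μ (e.symm z) (chartVec e z (1, 0))

/-- The coefficient of `dz₂` of a 1-form in the chart `e`. -/
def coeff₂ (μ : CovectorField X) (e : OpenPartialHomeomorph X (ℂ × ℂ)) (z : ℂ × ℂ) : ℂ :=
  μ (e.symm z) (chartVec e z (0, 1))

/-- `μ` is a holomorphic 1-form on `U`: its coefficients in holomorphic charts are holomorphic. -/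
def HolFormOn (μ : CovectorField X) (U : Set X) : Prop :=
  ∀ e : OpenPartialHomeomorph X (ℂ × ℂ), HolChart e → ∀ z ∈ e.target, e.symm z ∈ U →
    AnalyticAt ℂ (coeff₁ μ e) z ∧ AnalyticAt ℂ (coeff₂ μ e) z

/-- `dμ = 0` on `U`. -/
def ClosedFormOn (μ : CovectorField X) (U : Set X) : Prop :=
  ∀ e : OpenPartialHomeomorph X (ℂ × ℂ), HolChart e → ∀ z ∈ e.target, e.symm z ∈ U →
    partial₁ (coeff₂ μ e) z = partial₂ (coeff₁ μ e) z

/-! ### Symmetric 2-differentials -/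

/-- In the chart `e`, write `q = E dz₁² + 2F dz₁dz₂ + G dz₂²`; this is `E`. -/
def coeffE (q : QuadraticField X) (e : OpenPartialHomeomorph X (ℂ × ℂ)) (z : ℂ × ℂ) : ℂ :=
  q (e.symm z) (chartVec e z (1, 0))

/-- In the chart `e`, write `q = E dz₁² + 2F dz₁dz₂ + G dz₂²`; this is `F`. -/
def coeffF (q : QuadraticField X) (e : OpenPartialHomeomorph X (ℂ × ℂ)) (z : ℂ × ℂ) : ℂ :=
  QuadraticMap.polar (q (e.symm z)) (chartVec e z (1, 0)) (chartVec e z (0, 1)) / 2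

/-- In the chart `e`, write `q = E dz₁² + 2F dz₁dz₂ + G dz₂²`; this is `G`. -/
def coeffG (q : QuadraticField X) (e : OpenPartialHomeomorph X (ℂ × ℂ)) (z : ℂ × ℂ) : ℂ :=
  q (e.symm z) (chartVec e z (0, 1))

/-- `q` is a holomorphic section of `S²Ω¹` over `U`. -/
def HolQuadOn (q : QuadraticField X) (U : Set X) : Prop :=
  ∀ e : OpenPartialHomeomorph X (ℂ × ℂ), HolChart e → ∀ z ∈ e.target, e.symm z ∈ U →
    AnalyticAt ℂ (coeffE q e) z ∧ AnalyticAt ℂ (coeffF q e) z ∧ AnalyticAt ℂ (coeffG q e) z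

end

/-- Symmetric 2-differentials on `X`: global holomorphic sections of `S²Ω¹`. -/
structure SymmetricTwoDifferential (X : Type*) [TopologicalSpace X]
    [ChartedSpace (ℂ × ℂ) X] where
  toField : QuadraticField X
  holomorphic : HolQuadOn toField Set.univ

section

variable {X : Type*} [TopologicalSpace X] [ChartedSpace (ℂ × ℂ) X]

/-- `w` has rank 2: at a general point `x` it defines two distinct lines in the tangent space,
i.e. `w(x)` is the product of two linearly independent covectors. -/
def HasRankTwo (w : SymmetricTwoDifferential X) : Prop :=
  AtGeneralPoint fun x : X => ∃ α β : Module.Dual ℂ (TangentSpace surfaceModel x),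
    LinearIndependent ℂ ![α, β] ∧ ∀ v, w.toField x v = α v * β v

/-- `w = μ₁μ₂` near `x`, with closed holomorphic 1-forms `μ₁`, `μ₂`. -/
def HasClosedDecompositionAt (w : SymmetricTwoDifferential X) (x : X) : Prop :=
  ∃ U : Set X, IsOpen U ∧ x ∈ U ∧ ∃ μ₁ μ₂ : CovectorField X,
    HolFormOn μ₁ U ∧ ClosedFormOn μ₁ U ∧ HolFormOn μ₂ U ∧ ClosedFormOn μ₂ U ∧
    ∀ y ∈ U, ∀ v, w.toField y v = μ₁ y v * μ₂ y v

/-- `w` is closed: it has a holomorphic closed decomposition at a general point. -/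
def IsClosedDifferential (w : SymmetricTwoDifferential X) : Prop :=
  AtGeneralPoint fun x => HasClosedDecompositionAt w x

/-- `w` is of the 1st kind on `U`: it has holomorphic closed decompositions at all points
of `U` (used for open `U`). -/
def IsFirstKindOn (w : SymmetricTwoDifferential X) (U : Set X) : Prop :=
  ∀ x ∈ U, HasClosedDecompositionAt w x

/-! ### Discriminant and complexified Gaussian curvature -/

/-- The discriminant `EG - F²` of `q` in the chart `e`. -/
def discr (q : QuadraticField X) (e : OpenPartialHomeomorph X (ℂ × ℂ)) (z : ℂ × ℂ) : ℂ :=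
  coeffE q e z * coeffG q e z - coeffF q e z ^ 2

end

/-- Brioschi's formula for the Gaussian curvature of `E dz₁² + 2F dz₁dz₂ + G dz₂²`,
with holomorphic `E`, `F`, `G` and complex derivatives. -/
def brioschi (E F G : ℂ × ℂ → ℂ) (z : ℂ × ℂ) : ℂ :=
  (Matrix.det !![
      - partial₂ (partial₂ E) z / 2 + partial₂ (partial₁ F) z - partial₁ (partial₁ G) z / 2,
        partial₁ E z / 2, partial₁ F z - partial₂ E z / 2;
      partial₂ F z - partial₁ G z / 2, E z, F z;
      partial₂ G z / 2, F z, G z]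
    - Matrix.det !![
      0, partial₂ E z / 2, partial₁ G z / 2;
      partial₂ E z / 2, E z, F z;
      partial₁ G z / 2, F z, G z])
  / (E z * G z - F z ^ 2) ^ 2

section

variable {X : Type*} [TopologicalSpace X] [ChartedSpace (ℂ × ℂ) X]

/-- The complexified Gaussian curvature `K_ℂ(w)` in the chart `e`. It is a meromorphic function
with poles at most along the discriminant locus, so its values are meaningful where
`discr w.toField e z ≠ 0`. -/
def complexCurvature (w : SymmetricTwoDifferential X)
    (e : OpenPartialHomeomorph X (ℂ × ℂ)) (z : ℂ × ℂ) : ℂ :=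
  brioschi (coeffE w.toField e) (coeffF w.toField e) (coeffG w.toField e) z

/-- `K_ℂ(w) = 0` as a meromorphic function on `X`: in every holomorphic chart `K_ℂ(w)` vanishes
outside the discriminant locus. -/
def ComplexCurvatureVanishes (w : SymmetricTwoDifferential X) : Prop :=
  ∀ e : OpenPartialHomeomorph X (ℂ × ℂ), HolChart e → ∀ z ∈ e.target,
    discr w.toField e z ≠ 0 → complexCurvature w e z = 0

/-! ### The core discriminant divisor

Divisors on a manifold are described by their local equations, which are germs of holomorphic
functions, well defined up to units. -/

/-- `f` is holomorphic at (hence near) `x`. -/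
def HolFunAt (f : X → ℂ) (x : X) : Prop :=
  ContMDiffAt surfaceModel 𝓘(ℂ, ℂ) ω f x

/-- The germ at `x` of the holomorphic function `h` divides the germ of `w`:
`w = h ŵ` near `x`, with a holomorphic symmetric 2-differential `ŵ` near `x`. -/
def DividesAt (h : X → ℂ) (w : SymmetricTwoDifferential X) (x : X) : Prop :=
  ∃ U : Set X, IsOpen U ∧ x ∈ U ∧ HolFunOn h U ∧ ∃ q : QuadraticField X, HolQuadOn q U ∧
    ∀ y ∈ U, ∀ v, w.toField y v = h y * q y v

/-- `h` is a local equation at `x` of the divisor of zeros `(w)₀` of `w`: it is the greatest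
common divisor of (the coefficients of) `w` in the ring of germs of holomorphic functions. -/
def IsZeroDivisorEquation (w : SymmetricTwoDifferential X) (x : X) (h : X → ℂ) : Prop :=
  DividesAt h w x ∧ ∀ h' : X → ℂ, DividesAt h' w x →
    ∃ k : X → ℂ, HolFunAt k x ∧ ∀ᶠ y in 𝓝 x, h y = k y * h' y

/-- `δ` is a local equation at `x` of the core discriminant divisor `Disc⁰_w = Disc_w - 2 (w)₀`:
the discriminant of `w` is `δ h²`, with a local equation `h` of `(w)₀`. -/
def IsCoreDiscrEquation (w : SymmetricTwoDifferential X) (x : X) (δ : X → ℂ) : Prop :=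
  HolFunAt δ x ∧ ∃ h : X → ℂ, IsZeroDivisorEquation w x h ∧
    ∃ e : OpenPartialHomeomorph X (ℂ × ℂ), HolChart e ∧ x ∈ e.source ∧
      ∀ᶠ y in 𝓝 x, discr w.toField e (e y) = δ y * h y ^ 2

/-- The support of the core discriminant divisor: the points at which its local equations
vanish. -/
def coreDiscrSupport (w : SymmetricTwoDifferential X) : Set X :=
  {x | ∀ δ : X → ℂ, IsCoreDiscrEquation w x δ → δ x = 0}

end

end ClosedDiff

end

/-!
Near a point where `w` is nondegenerate, the two isotropic directions are holomorphic and
transversal line fields. By the holomorphic flow-box theorem (here via Lie series) each has a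
first integral with nonzero differential, and in the coordinates given by the two first integrals
`w = 2F dz₁dz₂`. There Brioschi's formula reduces to `K_ℂ(w) = -(∂₁∂₂ log F) / F`, so the
curvature vanishes exactly when `F = A(z₁) B(z₂)`, and then `w = (2A dz₁)(B dz₂)` is a product of
closed forms. Outside the core discriminant `w = h q` with `q` nondegenerate, and the null
coordinates of `q` serve for `w` as well: the factorization of `F`, obtained near a point where
`F ≠ 0`, extends by analytic continuation. The passage from general points to all points rests on
the density of complements of proper analytic subsets.
-/

noncomputable section

namespace ClosedDiff

open Metric Complex

/-! ### Osgood's lemma -/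

lemma exists_analyticAt_curry {K E : Type*} [TopologicalSpace K] [CompactSpace K]
    [NormedAddCommGroup E] [NormedSpace ℂ E] [CompleteSpace E] {f : ℂ × K → E} {c : ℂ} {r : ℝ}
    (hr : 0 < r) (hf : ContinuousOn f (closedBall c r ×ˢ Set.univ))
    (hd : ∀ k, DifferentiableOn ℂ (fun x => f (x, k)) (closedBall c r)) :
    ∃ H : ℂ → C(K, E), AnalyticAt ℂ H c ∧ ∀ x ∈ ball c r, ∀ k, H x k = f (x, k) := by
  have hcont : ∀ x ∈ closedBall c r, Continuous fun k => f (x, k) := fun x hx =>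
    hf.comp_continuous (by fun_prop) fun k => ⟨hx, trivial⟩
  have hslice : ∀ x, ∃ g : C(K, E), x ∈ closedBall c r → ∀ k, g k = f (x, k) := fun x => by
    by_cases hx : x ∈ closedBall c r
    · exact ⟨⟨_, hcont x hx⟩, fun _ _ => rfl⟩
    · exact ⟨0, fun h => absurd h hx⟩
  choose G hG using hslice
  have hGcont : ContinuousOn G (closedBall c r) := by
    rw [continuousOn_iff_continuous_domRestrict]
    refine ContinuousMap.continuous_of_continuous_uncurry _ ?_
    have huncurry : (Function.uncurry fun (x : closedBall c r) k => G x k) =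
        fun p => f (p.1, p.2) := funext fun p => hG p.1 p.1.2 p.2
    exact huncurry ▸ hf.comp_continuous (by fun_prop) fun p => ⟨p.1.2, trivial⟩
  have hGint : CircleIntegrable G c r :=
    (hGcont.mono sphere_subset_closedBall).circleIntegrable hr.le
  refine ⟨fun w => (2 * ↑Real.pi * I : ℂ)⁻¹ • ∮ z in C(c, r), (z - w)⁻¹ • G z,
    (hasFPowerSeriesOn_cauchy_integral (R := ⟨r, hr.le⟩) hGint hr).analyticAt, fun x hx k => ?_⟩
  have hcirc : CircleIntegrable (fun z => (z - x)⁻¹ • G z) c r := by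
    refine ContinuousOn.circleIntegrable hr.le (ContinuousOn.fun_smul (ContinuousOn.inv₀
      (by fun_prop) fun z hz h => ?_) (hGcont.mono sphere_subset_closedBall))
    exact (mem_ball.1 hx).ne (sub_eq_zero.1 h ▸ mem_sphere.1 hz)
  have heval : (∮ z in C(c, r), (z - x)⁻¹ • G z) k = ∮ z in C(c, r), (z - x)⁻¹ • G z k :=
    ((ContinuousMap.evalCLM ℂ k).intervalIntegral_comp_comm hcirc.out).symm
  have hcauchy : (∮ z in C(c, r), (z - x)⁻¹ • f (z, k)) = (2 * ↑Real.pi * I : ℂ) • f (x, k) :=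
    (((hd k).mono closure_ball_subset_closedBall).diffContOnCl).circleIntegral_sub_inv_smul hx
  rw [ContinuousMap.smul_apply, heval, circleIntegral.integral_congr hr.le fun z hz => by
    rw [hG z (sphere_subset_closedBall hz)], hcauchy, inv_smul_smul₀ two_pi_I_ne_zero]

/-- Integration over the circle against `dθ`, as a functional on continuous functions. -/
def circleFunctional : C(Circle, ℂ) →L[ℂ] ℂ :=
  LinearMap.mkContinuous
    { toFun := fun g => ∫ θ in (0 : ℝ)..2 * Real.pi, g (Circle.exp θ)
      map_add' := fun g h => intervalIntegral.integral_add
        (Continuous.intervalIntegrable (by fun_prop) _ _)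
        (Continuous.intervalIntegrable (by fun_prop) _ _)
      map_smul' := fun a _ => intervalIntegral.integral_smul a _ }
    |2 * Real.pi - 0| fun g =>
      (intervalIntegral.norm_integral_le_of_norm_le_const fun _ _ => g.norm_coe_le_norm _).trans_eq
        (mul_comm _ _)

lemma circleFunctional_eq_circleIntegral {f : ℂ → ℂ} {c y : ℂ} {r : ℝ} {g : C(Circle, ℂ)}
    (hg : ∀ ζ : Circle, g ζ = r * ζ / (c + r * ζ - y) * f (c + r * ζ)) :
    I * circleFunctional g = ∮ ζ in C(c, r), (ζ - y)⁻¹ • f ζ := by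
  change I * ∫ θ in (0 : ℝ)..2 * Real.pi, g (Circle.exp θ) = _
  rw [circleIntegral, ← intervalIntegral.integral_const_mul]
  refine intervalIntegral.integral_congr fun θ _ => ?_
  simp only [hg, deriv_circleMap, circleMap, Circle.coe_exp, smul_eq_mul, zero_add]
  ring

theorem analyticAt_of_separately {f : ℂ × ℂ → ℂ} {z₀ : ℂ × ℂ} {R : ℝ} (hR : 0 < R)
    (hf : ContinuousOn f (ball z₀ R))
    (h₁ : ∀ z ∈ ball z₀ R, DifferentiableAt ℂ (fun x => f (x, z.2)) z.1)
    (h₂ : ∀ z ∈ ball z₀ R, DifferentiableAt ℂ (fun y => f (z.1, y)) z.2) :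
    AnalyticAt ℂ f z₀ := by
  obtain ⟨r, hr, hrR⟩ := exists_between hR
  have hmem : ∀ {x y}, x ∈ closedBall z₀.1 r → y ∈ closedBall z₀.2 r → (x, y) ∈ ball z₀ R :=
    fun hx hy => closedBall_subset_ball hrR (closedBall_prod_same z₀.1 z₀.2 r ▸ ⟨hx, hy⟩)
  have hcircle : ∀ ζ : Circle, z₀.2 + r * (ζ : ℂ) ∈ sphere z₀.2 r := fun ζ => by
    simp [abs_of_pos hr, Circle.norm_coe]
  have hcircle' := fun ζ => sphere_subset_closedBall (hcircle ζ)
  obtain ⟨H, hH, hHf⟩ := exists_analyticAt_curry (K := Circle) (c := z₀.1) hr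
    (f := fun p => f (p.1, z₀.2 + r * (p.2 : ℂ)))
    (hf.comp (by fun_prop) fun p hp => hmem hp.1 (hcircle' p.2))
    fun ζ x hx => (h₁ _ (hmem hx (hcircle' ζ))).differentiableWithinAt
  have hpole : ∀ y ∈ closedBall z₀.2 (r / 2), ∀ ζ : Circle, z₀.2 + r * (ζ : ℂ) - y ≠ 0 :=
    fun y hy ζ h => by
      have := mem_closedBall.1 hy
      rw [← sub_eq_zero.1 h, mem_sphere.1 (hcircle ζ)] at this
      linarith
  obtain ⟨k, hk, hkf⟩ := exists_analyticAt_curry (K := Circle) (c := z₀.2) (half_pos hr)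
    (f := fun p => r * (p.2 : ℂ) / (z₀.2 + r * (p.2 : ℂ) - p.1))
    (ContinuousOn.div (by fun_prop) (by fun_prop) fun p hp => hpole _ hp.1 _)
    fun ζ => (differentiableOn_const (r * (ζ : ℂ))).fun_div
      (differentiableOn_id.const_sub (z₀.2 + r * (ζ : ℂ))) fun y hy => hpole y hy ζ
  have hP : AnalyticAt ℂ (fun z : ℂ × ℂ => (2 * Real.pi : ℂ)⁻¹ *
      circleFunctional (k z.2 * H z.1)) z₀ :=
    analyticAt_const.fun_mul <| (circleFunctional.analyticAt _).fun_comp <|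
      (hk.fun_comp analyticAt_snd).fun_mul (hH.fun_comp analyticAt_fst)
  refine hP.congr ?_
  filter_upwards [ball_mem_nhds z₀ (half_pos hr)] with z hz
  rw [← ball_prod_same] at hz
  have hz₁ : z.1 ∈ ball z₀.1 r := ball_subset_ball (by linarith) hz.1
  have hd : DiffContOnCl ℂ (fun y => f (z.1, y)) (ball z₀.2 r) :=
    DifferentiableOn.diffContOnCl fun y hy => (h₂ (z.1, y) (hmem (ball_subset_closedBall hz₁)
      (closure_ball_subset_closedBall hy))).differentiableWithinAt
  have hcauchy := hd.circleIntegral_sub_inv_smul (ball_subset_ball (by linarith) hz.2)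
  rw [← circleFunctional_eq_circleIntegral (g := k z.2 * H z.1) fun ζ => by
    rw [ContinuousMap.mul_apply, hkf _ hz.2, hHf _ hz₁], smul_eq_mul, mul_comm, ← eq_div_iff
    I_ne_zero] at hcauchy
  rw [hcauchy]
  field_simp

/-! ### First integrals of holomorphic vector fields -/

section LieSeries

variable {E : Type*} [NormedAddCommGroup E] [NormedSpace ℂ E]

/-- The derivative of a function along a vector field. -/
def lieDeriv (v : E → E) (g : E → ℂ) (z : E) : ℂ := fderiv ℂ g z (v z)

lemma analyticAt_lieDeriv {v : E → E} {g : E → ℂ} {z : E} (hv : AnalyticAt ℂ v z)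
    (hg : AnalyticAt ℂ g z) : AnalyticAt ℂ (lieDeriv v g) z :=
  ((ContinuousLinearMap.id ℂ (E →L[ℂ] ℂ)).analyticAt_bilinear (fderiv ℂ g z, v z)).comp_of_eq
    (hg.fderiv.prod hv) rfl

lemma analyticAt_lieDeriv_iterate {v : E → E} {g : E → ℂ} {z : E} (hv : AnalyticAt ℂ v z)
    (hg : AnalyticAt ℂ g z) : ∀ n, AnalyticAt ℂ ((lieDeriv v)^[n] g) z
  | 0 => hg
  | n + 1 => Function.iterate_succ_apply' (lieDeriv v) n g ▸
      analyticAt_lieDeriv hv (analyticAt_lieDeriv_iterate hv hg n)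

lemma norm_fderiv_apply_le_of_forall_norm_le {g : E → ℂ} {z a : E} {s C : ℝ} (hs : 0 < s)
    (hg : ∀ t ∈ closedBall (0 : ℂ) s, DifferentiableAt ℂ g (z + t • a))
    (hC : ∀ t ∈ closedBall (0 : ℂ) s, ‖g (z + t • a)‖ ≤ C) : ‖fderiv ℂ g z a‖ ≤ C / s := by
  have hgz : DifferentiableAt ℂ g z := by simpa using hg 0 (mem_closedBall_self hs.le)
  rw [← hgz.lineDeriv_eq_fderiv]
  refine norm_deriv_le_of_forall_mem_sphere_norm_le hs
    (DifferentiableOn.diffContOnCl fun t ht => ?_)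
    fun t ht => hC t (sphere_subset_closedBall ht)
  exact ((hg t (closure_ball_subset_closedBall ht)).comp t
    (by fun_prop : DifferentiableAt ℂ (fun t : ℂ => z + t • a) t)).differentiableWithinAt

lemma norm_lieDeriv_iterate_le_of_mem_ball {v : E → E} {g : E → ℂ} {z₀ : E} {R s C M : ℝ}
    (hs : 0 < s) (hM : 0 < M) (hv : AnalyticOnNhd ℂ v (ball z₀ R))
    (hg : AnalyticOnNhd ℂ g (ball z₀ R)) (hvM : ∀ z ∈ ball z₀ R, ‖v z‖ ≤ M)
    (hgC : ∀ z ∈ ball z₀ R, ‖g z‖ ≤ C) (n : ℕ) :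
    ∀ z ∈ ball z₀ (R - n * s), ‖(lieDeriv v)^[n] g z‖ ≤ C * (M / s) ^ n := by
  induction n with
  | zero => simpa using hgC
  | succ n ih =>
    intro z hz
    have hsub : ball z₀ (R - n * s) ⊆ ball z₀ R := ball_subset_ball (by
      have : 0 ≤ n * s := by positivity
      linarith)
    have hdisc : ∀ t ∈ closedBall (0 : ℂ) (s / M), z + t • v z ∈ ball z₀ (R - n * s) := by
      intro t ht
      have hvz : ‖v z‖ ≤ M := hvM z (hsub (ball_subset_ball (by push_cast; linarith) hz))
      have hshift : ‖t • v z‖ ≤ s := calc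
        ‖t • v z‖ = ‖t‖ * ‖v z‖ := norm_smul _ _
        _ ≤ s / M * M := by gcongr; exact mem_closedBall_zero_iff.1 ht
        _ = s := div_mul_cancel₀ s hM.ne'
      rw [mem_ball] at hz ⊢
      push_cast at hz
      have := dist_triangle (z + t • v z) z z₀
      rw [dist_self_add_left] at this
      linarith
    rw [Function.iterate_succ_apply', pow_succ, ← mul_assoc, ← mul_div_assoc,
      ← div_div_eq_mul_div]
    exact norm_fderiv_apply_le_of_forall_norm_le (div_pos hs hM)
      (fun t ht => (analyticAt_lieDeriv_iterate (hv _ (hsub (hdisc t ht)))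
        (hg _ (hsub (hdisc t ht))) n).differentiableAt) fun t ht => ih _ (hdisc t ht)

lemma exists_norm_lieDeriv_iterate_le [CompleteSpace E] {v : E → E} {g : E → ℂ} {z₀ : E}
    (hv : AnalyticAt ℂ v z₀) (hg : AnalyticAt ℂ g z₀) : ∃ C K : ℝ, 0 < K ∧
      ∀ᶠ z in 𝓝 z₀, ∀ n, ‖(lieDeriv v)^[n] g z‖ ≤ C * K ^ n * n.factorial := by
  have hvM : ∀ᶠ z in 𝓝 z₀, ‖v z‖ < ‖v z₀‖ + 1 :=
    hv.continuousAt.norm.eventually_lt continuousAt_const (lt_add_one _)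
  have hgC : ∀ᶠ z in 𝓝 z₀, ‖g z‖ < ‖g z₀‖ + 1 :=
    hg.continuousAt.norm.eventually_lt continuousAt_const (lt_add_one _)
  obtain ⟨R, hR, h⟩ := eventually_nhds_iff_ball.1
    (hv.eventually_analyticAt.and (hg.eventually_analyticAt.and (hvM.and hgC)))
  set M := ‖v z₀‖ + 1
  set C := ‖g z₀‖ + 1
  have hM : 0 < M := by positivity
  have : 0 < C := by positivity
  refine ⟨C, M / (R / 2) * Real.exp 1, by positivity, ?_⟩
  filter_upwards [ball_mem_nhds z₀ (half_pos hR)] with z hz n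
  rcases n.eq_zero_or_pos with rfl | hn
  · simpa using (h z (ball_subset_ball (by linarith) hz)).2.2.2.le
  -- Half of the radius is shared evenly among the `n` derivatives, which costs `nⁿ ≤ eⁿ n!`.
  have hn' : (0 : ℝ) < n := Nat.cast_pos.2 hn
  have hpow : (n : ℝ) ^ n ≤ Real.exp 1 ^ n * n.factorial := by
    rw [← div_le_iff₀ (by positivity), ← Real.exp_nat_mul, mul_one]
    exact Real.pow_div_factorial_le_exp n hn'.le n
  calc ‖(lieDeriv v)^[n] g z‖ ≤ C * (M / (R / 2 / n)) ^ n :=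
        norm_lieDeriv_iterate_le_of_mem_ball (by positivity) hM (fun z hz => (h z hz).1)
          (fun z hz => (h z hz).2.1) (fun z hz => (h z hz).2.2.1.le)
          (fun z hz => (h z hz).2.2.2.le) n z (by convert hz using 2; field_simp; ring)
    _ = C * (M / (R / 2)) ^ n * (n : ℝ) ^ n := by
        rw [mul_assoc, ← mul_pow]; congr 2; field_simp
    _ ≤ C * (M / (R / 2)) ^ n * (Real.exp 1 ^ n * n.factorial) := by gcongr
    _ = C * (M / (R / 2) * Real.exp 1) ^ n * n.factorial := by rw [mul_pow]; ring

/-- The `n`-th term of the Lie series `e^{-tL_v} f`, with the linear function `t = ℓ (z - z₀)` as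
time. If `ℓ (v z) = 1`, the sum of the series is the function which agrees with `f` on the
hyperplane `t = 0` and is constant along `v`. -/
def lieSeriesTerm (v : E → E) (ℓ : E →L[ℂ] ℂ) (z₀ : E) (f : E → ℂ) (n : ℕ) (z : E) : ℂ :=
  (-ℓ (z - z₀)) ^ n / n.factorial * (lieDeriv v)^[n] f z

variable {v : E → E} {ℓ : E →L[ℂ] ℂ} {z₀ : E} {f : E → ℂ}

lemma analyticAt_lieSeriesTerm {z : E} (hv : AnalyticAt ℂ v z) (hf : AnalyticAt ℂ f z) (n : ℕ) :
    AnalyticAt ℂ (lieSeriesTerm v ℓ z₀ f n) z := by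
  have hℓ : AnalyticAt ℂ (fun z => -ℓ (z - z₀)) z :=
    ((ℓ.analyticAt _).fun_comp (analyticAt_id.fun_sub analyticAt_const)).fun_neg
  exact ((hℓ.fun_pow n).fun_div analyticAt_const (Nat.cast_ne_zero.2 n.factorial_ne_zero)).fun_mul
    (analyticAt_lieDeriv_iterate hv hf n)

lemma exists_norm_lieSeriesTerm_le [CompleteSpace E] (hv : AnalyticAt ℂ v z₀)
    (hf : AnalyticAt ℂ f z₀) :
    ∃ C : ℝ, ∀ᶠ z in 𝓝 z₀, ∀ n, ‖lieSeriesTerm v ℓ z₀ f n z‖ ≤ C * (1 / 2) ^ n := by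
  obtain ⟨C, K, hK, hCK⟩ := exists_norm_lieDeriv_iterate_le hv hf
  have htime : ∀ᶠ z in 𝓝 z₀, K * ‖-ℓ (z - z₀)‖ < 1 / 2 :=
    ContinuousAt.eventually_lt (by fun_prop) continuousAt_const (by simp)
  refine ⟨C, ?_⟩
  filter_upwards [hCK, htime] with z hz ht n
  have hC : 0 ≤ C := by simpa using (norm_nonneg _).trans (hz 0)
  have hfact : (n.factorial : ℝ) ≠ 0 := Nat.cast_ne_zero.2 n.factorial_ne_zero
  calc ‖lieSeriesTerm v ℓ z₀ f n z‖
      = ‖-ℓ (z - z₀)‖ ^ n / n.factorial * ‖(lieDeriv v)^[n] f z‖ := by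
        rw [lieSeriesTerm, norm_mul, norm_div, norm_pow, Complex.norm_natCast]
    _ ≤ ‖-ℓ (z - z₀)‖ ^ n / n.factorial * (C * K ^ n * n.factorial) := by gcongr; exact hz n
    _ = C * (K * ‖-ℓ (z - z₀)‖) ^ n := by rw [mul_pow]; field_simp
    _ ≤ C * (1 / 2) ^ n := by gcongr

lemma fderiv_lieSeriesTerm_succ_apply {z : E} (hv : AnalyticAt ℂ v z) (hf : AnalyticAt ℂ f z)
    (hℓ : ℓ (v z) = 1) (n : ℕ) : fderiv ℂ (lieSeriesTerm v ℓ z₀ f (n + 1)) z (v z) =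
      lieSeriesTerm v ℓ z₀ (lieDeriv v f) (n + 1) z - lieSeriesTerm v ℓ z₀ (lieDeriv v f) n z := by
  have htime : HasFDerivAt (fun z => -ℓ (z - z₀)) (-ℓ) z :=
    (ℓ.hasFDerivAt.comp z ((hasFDerivAt_id z).sub_const z₀)).fun_neg
  have hiter := (analyticAt_lieDeriv_iterate hv hf (n + 1)).differentiableAt.hasFDerivAt
  have hLie : fderiv ℂ ((lieDeriv v)^[n + 1] f) z (v z) =
      (lieDeriv v)^[n + 1] (lieDeriv v f) z := by
    rw [← Function.iterate_succ_apply, Function.iterate_succ_apply' _ (n + 1)]; rfl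
  have hterm := ((htime.pow (n + 1)).mul_const ((n + 1).factorial : ℂ)⁻¹).mul hiter
  have hfact : (n.factorial : ℂ) ≠ 0 := Nat.cast_ne_zero.2 n.factorial_ne_zero
  have hn : (n : ℂ) + 1 ≠ 0 := Nat.cast_add_one_ne_zero n
  have := hterm.fderiv
  change fderiv ℂ (lieSeriesTerm v ℓ z₀ f (n + 1)) z = _ at this
  rw [this]
  simp only [lieSeriesTerm, Nat.factorial_succ, Nat.add_sub_cancel, add_apply,
    smul_apply, neg_apply, hLie, hℓ, smul_eq_mul, nsmul_eq_mul]
  rw [Function.iterate_succ_apply _ n f]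
  push_cast
  field_simp
  ring

end LieSeries

lemma analyticAt_tsum {F : ℕ → ℂ × ℂ → ℂ} {z₀ : ℂ × ℂ} {c : ℕ → ℝ} (hc : Summable c)
    (hF : ∀ᶠ z in 𝓝 z₀, ∀ n, AnalyticAt ℂ (F n) z) (hb : ∀ᶠ z in 𝓝 z₀, ∀ n, ‖F n z‖ ≤ c n) :
    AnalyticAt ℂ (fun z => ∑' n, F n z) z₀ := by
  obtain ⟨R, hR, h⟩ := eventually_nhds_iff_ball.1 (hF.and hb)
  have hslice : ∀ {j : ℂ → ℂ × ℂ} {t : ℂ}, Differentiable ℂ j → j t ∈ ball z₀ R →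
      DifferentiableAt ℂ (fun t => ∑' n, F n (j t)) t := fun {j t} hj ht => by
    have hopen : IsOpen (j ⁻¹' ball z₀ R) := isOpen_ball.preimage hj.continuous
    refine (differentiableOn_tsum_of_summable_norm hc (fun n s hs => ?_) hopen
      fun n s hs => (h _ hs).2 n).differentiableAt (hopen.mem_nhds ht)
    exact (((h _ hs).1 n).differentiableAt.comp s hj.differentiableAt).differentiableWithinAt
  refine analyticAt_of_separately hR
    (continuousOn_tsum (fun n z hz => ((h z hz).1 n).continuousAt.continuousWithinAt) hc
      fun n z hz => (h z hz).2 n)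
    (fun z hz => hslice (j := fun x => (x, z.2)) (by fun_prop) hz)
    fun z hz => hslice (j := fun y => (z.1, y)) (by fun_prop) hz

lemma hasSum_fderiv_apply {F : ℕ → ℂ × ℂ → ℂ} {z₀ : ℂ × ℂ} {c : ℕ → ℝ} (hc : Summable c)
    (hF : ∀ᶠ z in 𝓝 z₀, ∀ n, AnalyticAt ℂ (F n) z) (hb : ∀ᶠ z in 𝓝 z₀, ∀ n, ‖F n z‖ ≤ c n)
    (a : ℂ × ℂ) :
    HasSum (fun n => fderiv ℂ (F n) z₀ a) (fderiv ℂ (fun z => ∑' n, F n z) z₀ a) := by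
  obtain ⟨R, hR, h⟩ := eventually_nhds_iff_ball.1 (hF.and hb)
  have hopen : IsOpen ((fun t : ℂ => z₀ + t • a) ⁻¹' ball z₀ R) :=
    isOpen_ball.preimage (by fun_prop)
  have hline := hasSum_deriv_of_summable_norm (F := fun n t => F n (z₀ + t • a)) (z := 0) hc
    (fun n t ht => (((h _ ht).1 n).differentiableAt.comp t (by fun_prop)).differentiableWithinAt)
    hopen (fun n t ht => (h _ ht).2 n) (by
      change z₀ + (0 : ℂ) • a ∈ ball z₀ R
      simpa using hR)
  have hF₀ : ∀ n, lineDeriv ℂ (F n) z₀ a = fderiv ℂ (F n) z₀ a := fun n =>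
    ((h z₀ (mem_ball_self hR)).1 n).differentiableAt.lineDeriv_eq_fderiv
  rw [← (analyticAt_tsum hc hF hb).differentiableAt.lineDeriv_eq_fderiv]
  simp only [← hF₀]
  exact hline

theorem exists_lieDeriv_eq_zero_eq_on_hyperplane {v : ℂ × ℂ → ℂ × ℂ} {f : ℂ × ℂ → ℂ} {z₀ : ℂ × ℂ}
    {ℓ : ℂ × ℂ →L[ℂ] ℂ} (hv : AnalyticAt ℂ v z₀) (hf : AnalyticAt ℂ f z₀)
    (hℓ : ∀ᶠ z in 𝓝 z₀, ℓ (v z) = 1) :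
    ∃ u : ℂ × ℂ → ℂ, AnalyticAt ℂ u z₀ ∧ (∀ᶠ z in 𝓝 z₀, lieDeriv v u z = 0) ∧
      ∀ z, ℓ (z - z₀) = 0 → u z = f z := by
  obtain ⟨C, hC⟩ := exists_norm_lieSeriesTerm_le (ℓ := ℓ) hv hf
  obtain ⟨C', hC'⟩ := exists_norm_lieSeriesTerm_le (ℓ := ℓ) hv (analyticAt_lieDeriv hv hf)
  have hgeom : Summable fun n : ℕ => (1 / 2 : ℝ) ^ n :=
    summable_geometric_of_lt_one (by norm_num) (by norm_num)
  have han : ∀ᶠ z in 𝓝 z₀, ∀ n, AnalyticAt ℂ (lieSeriesTerm v ℓ z₀ f n) z := by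
    filter_upwards [hv.eventually_analyticAt, hf.eventually_analyticAt] with z hvz hfz
    exact analyticAt_lieSeriesTerm hvz hfz
  refine ⟨fun z => ∑' n, lieSeriesTerm v ℓ z₀ f n z, analyticAt_tsum (hgeom.mul_left C) han hC,
    ?_, fun z hz => ?_⟩
  · filter_upwards [han.eventually_nhds, hC.eventually_nhds, hC', hv.eventually_analyticAt,
      hf.eventually_analyticAt, hℓ] with z hanz hCz hC'z hvz hfz hℓz
    -- Differentiated along `v`, the Lie series telescopes.
    have hpartial : ∀ N, ∑ n ∈ Finset.range (N + 1), fderiv ℂ (lieSeriesTerm v ℓ z₀ f n) z (v z) =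
        lieSeriesTerm v ℓ z₀ (lieDeriv v f) N z := fun N => by
      induction N with
      | zero =>
        have : lieSeriesTerm v ℓ z₀ f 0 = f := by ext; simp [lieSeriesTerm]
        simp [this, lieSeriesTerm, lieDeriv]
      | succ N ih =>
        rw [Finset.sum_range_succ, ih, fderiv_lieSeriesTerm_succ_apply hvz hfz hℓz]
        ring
    have hsum := (Filter.tendsto_add_atTop_iff_nat 1).2
      (hasSum_fderiv_apply (hgeom.mul_left C) hanz hCz (v z)).tendsto_sum_nat
    simp only [hpartial] at hsum
    exact tendsto_nhds_unique hsum <|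
      ((hgeom.mul_left C').of_norm_bounded hC'z).tendsto_atTop_zero
  · change ∑' n, lieSeriesTerm v ℓ z₀ f n z = f z
    rw [tsum_eq_single 0 fun n hn => by simp [lieSeriesTerm, hz, hn]]
    simp [lieSeriesTerm]

theorem exists_firstIntegral {v : ℂ × ℂ → ℂ × ℂ} {z₀ : ℂ × ℂ} (hv : AnalyticAt ℂ v z₀)
    (hv₀ : v z₀ ≠ 0) (φ : ℂ × ℂ →L[ℂ] ℂ) (hφ : φ (v z₀) = 0) :
    ∃ u : ℂ × ℂ → ℂ, AnalyticAt ℂ u z₀ ∧ fderiv ℂ u z₀ = φ ∧ ∀ᶠ z in 𝓝 z₀, lieDeriv v u z = 0 := by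
  obtain ⟨ℓ, hℓ₀⟩ := SeparatingDual.exists_eq_one (R := ℂ) hv₀
  have hℓv : AnalyticAt ℂ (fun z => ℓ (v z)) z₀ := (ℓ.analyticAt _).fun_comp hv
  have hℓ : ∀ᶠ z in 𝓝 z₀, ℓ (v z) ≠ 0 :=
    hℓv.continuousAt.eventually_ne (hℓ₀.trans_ne one_ne_zero)
  obtain ⟨u, hu, huv, huφ⟩ := exists_lieDeriv_eq_zero_eq_on_hyperplane (ℓ := ℓ)
    ((hℓv.fun_inv (hℓ₀.trans_ne one_ne_zero)).fun_smul hv) (φ.analyticAt z₀)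
    (hℓ.mono fun z hz => by simp [hz])
  have huv' : ∀ᶠ z in 𝓝 z₀, lieDeriv v u z = 0 := by
    filter_upwards [huv, hℓ] with z hz hℓz
    simpa [lieDeriv, hℓz] using hz
  refine ⟨u, hu, ?_, huv'⟩
  have hker : ∀ a, ℓ a = 0 → fderiv ℂ u z₀ a = φ a := fun a ha => by
    rw [← hu.differentiableAt.lineDeriv_eq_fderiv,
      ← (φ.fderiv (x := z₀)), ← φ.differentiableAt.lineDeriv_eq_fderiv, lineDeriv, lineDeriv]
    exact congrArg (deriv · 0) (funext fun t => huφ _ (by simp [ha]))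
  refine ContinuousLinearMap.ext fun a => ?_
  have hsplit : a = (a - ℓ a • v z₀) + ℓ a • v z₀ := (sub_add_cancel _ _).symm
  have huv₀ : fderiv ℂ u z₀ (v z₀) = 0 := huv'.self_of_nhds
  rw [hsplit, map_add, map_add, hker _ (by simp [hℓ₀]), map_smul, map_smul, huv₀, hφ]

/-! ### Partial derivatives -/

section

variable {E : Type*} [NormedAddCommGroup E] [NormedSpace ℂ E] {u v : E → E} {f g : E → ℂ} {z : E}

lemma lieDeriv_congr (v : E → E) (h : f =ᶠ[𝓝 z] g) : lieDeriv v f =ᶠ[𝓝 z] lieDeriv v g :=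
  (h.fderiv (𝕜 := ℂ)).mono fun y hy => congrArg (· (v y)) hy

lemma lieDeriv_mul (hf : DifferentiableAt ℂ f z) (hg : DifferentiableAt ℂ g z) :
    lieDeriv v (f * g) z = lieDeriv v f z * g z + f z * lieDeriv v g z := by
  simp only [lieDeriv, fderiv_mul hf hg, add_apply, smul_apply, smul_eq_mul]
  ring

lemma lieDeriv_half_add (hf : DifferentiableAt ℂ f z) (hg : DifferentiableAt ℂ g z) :
    lieDeriv v (fun y => (f y + g y) / 2) z = (lieDeriv v f z + lieDeriv v g z) / 2 := by
  simp only [lieDeriv, div_eq_mul_inv, fderiv_mul_const (hf.fun_add hg), fderiv_fun_add hf hg,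
    add_apply, smul_apply, smul_eq_mul]
  ring

lemma lieDeriv_lieDeriv_mul [CompleteSpace E] (hv : AnalyticAt ℂ v z) (hf : AnalyticAt ℂ f z)
    (hg : AnalyticAt ℂ g z) :
    lieDeriv u (lieDeriv v (f * g)) z =
      lieDeriv u (lieDeriv v f) z * g z + lieDeriv v f z * lieDeriv u g z +
        (lieDeriv u f z * lieDeriv v g z + f z * lieDeriv u (lieDeriv v g) z) := by
  have hprod : lieDeriv v (f * g) =ᶠ[𝓝 z] lieDeriv v f * g + f * lieDeriv v g := by
    filter_upwards [hf.eventually_analyticAt, hg.eventually_analyticAt] with y hfy hgy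
    exact lieDeriv_mul hfy.differentiableAt hgy.differentiableAt
  have hf' := hf.differentiableAt
  have hg' := hg.differentiableAt
  have hvf := (analyticAt_lieDeriv hv hf).differentiableAt
  have hvg := (analyticAt_lieDeriv hv hg).differentiableAt
  rw [(lieDeriv_congr u hprod).eq_of_nhds, ← lieDeriv_mul hvf hg', ← lieDeriv_mul hf' hvg, lieDeriv,
    fderiv_add (hvf.mul hg') (hf'.mul hvg)]
  rfl

lemma lieDeriv_lieDeriv_half_add [CompleteSpace E] (hv : AnalyticAt ℂ v z) (hf : AnalyticAt ℂ f z)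
    (hg : AnalyticAt ℂ g z) :
    lieDeriv u (lieDeriv v fun y => (f y + g y) / 2) z =
      (lieDeriv u (lieDeriv v f) z + lieDeriv u (lieDeriv v g) z) / 2 := by
  have hsum : lieDeriv v (fun y => (f y + g y) / 2) =ᶠ[𝓝 z]
      fun y => (lieDeriv v f y + lieDeriv v g y) / 2 := by
    filter_upwards [hf.eventually_analyticAt, hg.eventually_analyticAt] with y hfy hgy
    exact lieDeriv_half_add hfy.differentiableAt hgy.differentiableAt
  rw [(lieDeriv_congr u hsum).eq_of_nhds, lieDeriv_half_add
    (analyticAt_lieDeriv hv hf).differentiableAt (analyticAt_lieDeriv hv hg).differentiableAt]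

end

lemma partial₁_eq_lieDeriv : partial₁ = lieDeriv fun _ => ((1, 0) : ℂ × ℂ) := rfl

lemma partial₂_eq_lieDeriv : partial₂ = lieDeriv fun _ => ((0, 1) : ℂ × ℂ) := rfl

section

variable {f g : ℂ × ℂ → ℂ} {z : ℂ × ℂ}

lemma partial₁_congr (h : f =ᶠ[𝓝 z] g) : partial₁ f =ᶠ[𝓝 z] partial₁ g := lieDeriv_congr _ h

lemma partial₂_congr (h : f =ᶠ[𝓝 z] g) : partial₂ f =ᶠ[𝓝 z] partial₂ g := lieDeriv_congr _ h

@[fun_prop]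
lemma analyticAt_partial₁ (hf : AnalyticAt ℂ f z) : AnalyticAt ℂ (partial₁ f) z :=
  analyticAt_lieDeriv analyticAt_const hf

@[fun_prop]
lemma analyticAt_partial₂ (hf : AnalyticAt ℂ f z) : AnalyticAt ℂ (partial₂ f) z :=
  analyticAt_lieDeriv analyticAt_const hf

lemma partial₁_partial₂ (hf : AnalyticAt ℂ f z) :
    partial₁ (partial₂ f) z = partial₂ (partial₁ f) z := by
  have hsnd : ∀ a b : ℂ × ℂ,
      fderiv ℂ (fun y => fderiv ℂ f y a) z b = fderiv ℂ (fderiv ℂ f) z b a := fun a b => by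
    simp [fderiv_clm_apply hf.fderiv.differentiableAt (differentiableAt_const a)]
  have hsymm : IsSymmSndFDerivAt ℂ f z := (hf.contDiffAt (n := ω)).isSymmSndFDerivAt (by simp)
  exact (hsnd _ _).trans ((hsymm.eq _ _).trans (hsnd _ _).symm)

lemma hasDerivAt_partial₁ {x y : ℂ} (hf : DifferentiableAt ℂ f (x, y)) :
    HasDerivAt (fun t => f (t, y)) (partial₁ f (x, y)) x :=
  hf.hasFDerivAt.comp_hasDerivAt x ((hasDerivAt_id x).prodMk (hasDerivAt_const x y))

lemma hasDerivAt_partial₂ {x y : ℂ} (hf : DifferentiableAt ℂ f (x, y)) :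
    HasDerivAt (fun t => f (x, t)) (partial₂ f (x, y)) y :=
  hf.hasFDerivAt.comp_hasDerivAt y ((hasDerivAt_const y x).prodMk (hasDerivAt_id y))

end

/-! ### Brioschi's formula -/

section

variable {E F G : ℂ × ℂ → ℂ} {z : ℂ × ℂ}

lemma brioschi_congr {E' F' G' : ℂ × ℂ → ℂ} (hE : E =ᶠ[𝓝 z] E') (hF : F =ᶠ[𝓝 z] F')
    (hG : G =ᶠ[𝓝 z] G') : brioschi E F G z = brioschi E' F' G' z := by
  have hE₁ := partial₁_congr hE
  have hE₂ := partial₂_congr hE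
  have hF₁ := partial₁_congr hF
  have hF₂ := partial₂_congr hF
  have hG₁ := partial₁_congr hG
  have hG₂ := partial₂_congr hG
  simp only [brioschi, hE.eq_of_nhds, hF.eq_of_nhds, hG.eq_of_nhds, hE₁.eq_of_nhds,
    hE₂.eq_of_nhds, hF₁.eq_of_nhds, hF₂.eq_of_nhds, hG₁.eq_of_nhds, hG₂.eq_of_nhds,
    (partial₂_congr hE₂).eq_of_nhds, (partial₂_congr hF₁).eq_of_nhds,
    (partial₁_congr hG₁).eq_of_nhds]

lemma continuousAt_brioschi (hE : AnalyticAt ℂ E z) (hF : AnalyticAt ℂ F z)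
    (hG : AnalyticAt ℂ G z) (hd : E z * G z - F z ^ 2 ≠ 0) :
    ContinuousAt (brioschi E F G) z := by
  suffices AnalyticAt ℂ (brioschi E F G) z from this.continuousAt
  unfold brioschi
  simp only [Matrix.det_fin_three, Matrix.of_apply, Matrix.cons_val', Matrix.cons_val_zero,
    Matrix.cons_val_one, Matrix.cons_val]
  exact AnalyticAt.fun_div (by fun_prop (disch := norm_num)) (by fun_prop) (pow_ne_zero 2 hd)

theorem brioschi_mul_of_closed {a₁ a₂ b₁ b₂ : ℂ × ℂ → ℂ}
    (ha₁ : AnalyticAt ℂ a₁ z) (ha₂ : AnalyticAt ℂ a₂ z)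
    (hb₁ : AnalyticAt ℂ b₁ z) (hb₂ : AnalyticAt ℂ b₂ z)
    (ha : partial₁ a₂ =ᶠ[𝓝 z] partial₂ a₁) (hb : partial₁ b₂ =ᶠ[𝓝 z] partial₂ b₁) :
    brioschi (a₁ * b₁) (fun y => ((a₁ * b₂) y + (a₂ * b₁) y) / 2) (a₂ * b₂) z = 0 := by
  have ha₁₁ : partial₁ (partial₁ a₂) z = partial₂ (partial₁ a₁) z :=
    (partial₁_congr ha).eq_of_nhds.trans (partial₁_partial₂ ha₁)
  have ha₁₂ : partial₂ (partial₁ a₂) z = partial₂ (partial₂ a₁) z := (partial₂_congr ha).eq_of_nhds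
  have hb₁₁ : partial₁ (partial₁ b₂) z = partial₂ (partial₁ b₁) z :=
    (partial₁_congr hb).eq_of_nhds.trans (partial₁_partial₂ hb₁)
  have hb₁₂ : partial₂ (partial₁ b₂) z = partial₂ (partial₂ b₁) z := (partial₂_congr hb).eq_of_nhds
  have ha' := ha.eq_of_nhds
  have hb' := hb.eq_of_nhds
  rw [brioschi, Matrix.det_fin_three, Matrix.det_fin_three, div_eq_zero_iff]
  left
  simp only [partial₁_eq_lieDeriv, partial₂_eq_lieDeriv] at *
  simp only [
    lieDeriv_half_add (ha₁.mul hb₂).differentiableAt (ha₂.mul hb₁).differentiableAt,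
    lieDeriv_lieDeriv_half_add analyticAt_const (ha₁.mul hb₂) (ha₂.mul hb₁),
    lieDeriv_lieDeriv_mul analyticAt_const ha₁ hb₁, lieDeriv_lieDeriv_mul analyticAt_const ha₁ hb₂,
    lieDeriv_lieDeriv_mul analyticAt_const ha₂ hb₁, lieDeriv_lieDeriv_mul analyticAt_const ha₂ hb₂,
    lieDeriv_mul ha₁.differentiableAt hb₁.differentiableAt,
    lieDeriv_mul ha₁.differentiableAt hb₂.differentiableAt,
    lieDeriv_mul ha₂.differentiableAt hb₁.differentiableAt,
    lieDeriv_mul ha₂.differentiableAt hb₂.differentiableAt]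
  simp only [Matrix.of_apply, Matrix.cons_val', Matrix.cons_val_zero, Matrix.cons_val_one,
    Matrix.cons_val, Pi.mul_apply, ha₁₁, ha₁₂, hb₁₁, hb₁₂, ha', hb']
  ring

lemma brioschi_zero_zero (F : ℂ × ℂ → ℂ) (z : ℂ × ℂ) : brioschi 0 F 0 z =
    (partial₁ F z * partial₂ F z - F z * partial₂ (partial₁ F) z) / F z ^ 3 := by
  have h₁ : partial₁ 0 = 0 := by ext; simp [partial₁]
  have h₂ : partial₂ 0 = 0 := by ext; simp [partial₂]
  rw [brioschi, Matrix.det_fin_three, Matrix.det_fin_three]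
  simp only [h₁, h₂, Pi.zero_apply, Matrix.of_apply, Matrix.cons_val', Matrix.cons_val_zero,
    Matrix.cons_val_one, Matrix.cons_val]
  rcases eq_or_ne (F z) 0 with hF | hF
  · simp [hF]
  · field_simp
    ring

end

lemma mul_eq_mul_of_wronskian_eq_zero {f g f' g' : ℂ → ℂ} {s : Set ℂ} (hs : IsOpen s)
    (hs' : IsPreconnected s) (hf : ∀ t ∈ s, HasDerivAt f (f' t) t)
    (hg : ∀ t ∈ s, HasDerivAt g (g' t) t) (hg₀ : ∀ t ∈ s, g t ≠ 0)
    (h : ∀ t ∈ s, f' t * g t = f t * g' t) {x y : ℂ} (hx : x ∈ s) (hy : y ∈ s) :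
    f x * g y = f y * g x := by
  have hder : ∀ t ∈ s, HasDerivAt (fun t => f t / g t) 0 t := fun t ht =>
    ((hf t ht).fun_div (hg t ht) (hg₀ t ht)).congr_deriv (by rw [h t ht, sub_self, zero_div])
  have hquot : f x / g x = f y / g y := hs.is_const_of_deriv_eq_zero hs'
    (fun t ht => (hder t ht).differentiableAt.differentiableWithinAt)
    (fun t ht => (hder t ht).deriv) hx hy
  rwa [div_eq_div_iff (hg₀ x hx) (hg₀ y hy)] at hquot

section

variable {c : ℂ × ℂ → ℂ} {p : ℂ × ℂ} {r : ℝ}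

/-- The condition says that `∂₁∂₂ log c = 0`. -/
lemma mul_eq_mul_swap_of_partial (hc : AnalyticOnNhd ℂ c (ball p r)) (hc₀ : ∀ z ∈ ball p r, c z ≠ 0)
    (h : ∀ z ∈ ball p r, partial₂ (partial₁ c) z * c z = partial₁ c z * partial₂ c z) {z w : ℂ × ℂ}
    (hz : z ∈ ball p r) (hw : w ∈ ball p r) : c z * c w = c (w.1, z.2) * c (z.1, w.2) := by
  obtain ⟨x₀, y₀⟩ := w
  rw [← ball_prod_same] at *
  have hlog : ∀ x ∈ ball p.1 r, partial₁ c (x, z.2) * c (x, y₀) = partial₁ c (x, y₀) * c (x, z.2) :=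
    fun x hx => mul_eq_mul_of_wronskian_eq_zero isOpen_ball (convex_ball p.2 r).isPreconnected
      (fun y hy => hasDerivAt_partial₂ (analyticAt_partial₁ (hc _ ⟨hx, hy⟩)).differentiableAt)
      (fun y hy => hasDerivAt_partial₂ (hc _ ⟨hx, hy⟩).differentiableAt)
      (fun y hy => hc₀ _ ⟨hx, hy⟩) (fun y hy => h _ ⟨hx, hy⟩) hz.2 hw.2
  exact mul_eq_mul_of_wronskian_eq_zero isOpen_ball (convex_ball p.1 r).isPreconnected
    (fun x hx => hasDerivAt_partial₁ (hc (x, z.2) ⟨hx, hz.2⟩).differentiableAt)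
    (fun x hx => hasDerivAt_partial₁ (hc (x, y₀) ⟨hx, hw.2⟩).differentiableAt)
    (fun x hx => hc₀ _ ⟨hx, hw.2⟩) (fun x hx => (hlog x hx).trans (mul_comm _ _)) hz.1 hw.1

theorem exists_eq_mul_of_partial (hc : AnalyticOnNhd ℂ c (ball p r))
    (h : ∀ z ∈ ball p r, c z ≠ 0 →
      partial₂ (partial₁ c) z * c z = partial₁ c z * partial₂ c z) :
    ∃ A B : ℂ → ℂ, DifferentiableOn ℂ A (ball p.1 r) ∧ DifferentiableOn ℂ B (ball p.2 r) ∧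
      ∀ z ∈ ball p r, c z = A z.1 * B z.2 := by
  by_cases hzero : ∀ z ∈ ball p r, c z = 0
  · exact ⟨0, 0, differentiableOn_const 0, differentiableOn_const 0,
      fun z hz => by simp [hzero z hz]⟩
  push Not at hzero
  obtain ⟨w, hw, hcw⟩ := hzero
  have hmem : ∀ {x y}, x ∈ ball p.1 r → y ∈ ball p.2 r → (x, y) ∈ ball p r :=
    fun hx hy => ball_prod_same p.1 p.2 r ▸ ⟨hx, hy⟩
  have hw' : w.1 ∈ ball p.1 r ∧ w.2 ∈ ball p.2 r := by rwa [← ball_prod_same] at hw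
  obtain ⟨ε, hε, hball⟩ := eventually_nhds_iff_ball.1 <|
    (isOpen_ball.eventually_mem hw).and ((hc w hw).continuousAt.eventually_ne hcw)
  have hloc : ∀ᶠ z in 𝓝 w, c z * c w = c (w.1, z.2) * c (z.1, w.2) := by
    filter_upwards [ball_mem_nhds w hε] with z hz
    exact mul_eq_mul_swap_of_partial (fun y hy => hc y (hball y hy).1)
      (fun y hy => (hball y hy).2) (fun y hy => h y (hball y hy).1 (hball y hy).2) hz
      (mem_ball_self hε)
  have hglob : Set.EqOn (fun z => c z * c w) (fun z => c (w.1, z.2) * c (z.1, w.2)) (ball p r) := by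
    refine AnalyticOnNhd.eqOn_of_preconnected_of_eventuallyEq
      (fun z hz => (hc z hz).fun_mul analyticAt_const) (fun z hz => ?_)
      (convex_ball p r).isPreconnected hw hloc
    rw [← ball_prod_same] at hz
    exact ((hc _ (hmem hw'.1 hz.2)).comp_of_eq (analyticAt_const.prod analyticAt_snd) rfl).fun_mul
      ((hc _ (hmem hz.1 hw'.2)).comp_of_eq (analyticAt_fst.prod analyticAt_const) rfl)
  refine ⟨fun x => c (x, w.2), fun y => c (w.1, y) / c w, fun x hx => ?_, fun y hy => ?_,
    fun z hz => ?_⟩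
  · have hd := hasDerivAt_partial₁ (hc _ (hmem hx hw'.2)).differentiableAt
    exact hd.differentiableAt.differentiableWithinAt
  · have hd := hasDerivAt_partial₂ (hc _ (hmem hw'.1 hy)).differentiableAt
    exact (hd.differentiableAt.div_const _).differentiableWithinAt
  · rw [← mul_div_assoc, eq_div_iff hcw, mul_comm (c (z.1, w.2))]
    exact hglob hz

end

/-! ### Null coordinates -/

lemma exists_contDiffOn_openPartialHomeomorph {𝕜 E F : Type*} [RCLike 𝕜] [NormedAddCommGroup E]
    [NormedSpace 𝕜 E] [CompleteSpace E] [NormedAddCommGroup F] [NormedSpace 𝕜 F] {n : ℕ∞ω}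
    {f : E → F} {f' : E ≃L[𝕜] F} {p : E} (hf : ContDiffAt 𝕜 n f p)
    (hf' : HasFDerivAt f (f' : E →L[𝕜] F) p) (hn : n ≠ 0) (hn' : n ≠ ∞) :
    ∃ φ : OpenPartialHomeomorph E F, p ∈ φ.source ∧ φ = f ∧
      ContDiffOn 𝕜 n φ φ.source ∧ ContDiffOn 𝕜 n φ.symm φ.target :=
  let φ := hf.toOpenPartialHomeomorph f hf' hn
  have hp : p ∈ φ.source := hf.mem_toOpenPartialHomeomorph_source hf' hn
  ⟨φ.restrContDiff 𝕜 n hn', ⟨hp, hf, hf.to_localInverse hf' hn⟩, rfl,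
    φ.contDiffOn_restrContDiff_source 𝕜 hn', φ.contDiffOn_restrContDiff_target 𝕜 hn'⟩

/-- The coordinates are first integrals of `V₂` and `V₁`, respectively. -/
theorem exists_coordinates_of_transversal {V₁ V₂ : ℂ × ℂ → ℂ × ℂ} {p : ℂ × ℂ}
    (h₁ : AnalyticAt ℂ V₁ p) (h₂ : AnalyticAt ℂ V₂ p)
    (hdet : (V₁ p).1 * (V₂ p).2 - (V₁ p).2 * (V₂ p).1 ≠ 0) :
    ∃ φ : OpenPartialHomeomorph (ℂ × ℂ) (ℂ × ℂ), p ∈ φ.source ∧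
      ContDiffOn ℂ ω φ φ.source ∧ ContDiffOn ℂ ω φ.symm φ.target ∧
      ∀ᶠ z in 𝓝 (φ p), ∃ k₁ k₂ : ℂ, V₁ (φ.symm z) = k₁ • fderiv ℂ φ.symm z (1, 0) ∧
        V₂ (φ.symm z) = k₂ • fderiv ℂ φ.symm z (0, 1) := by
  obtain ⟨u, hu, hu', huV⟩ := exists_firstIntegral h₂ (fun h => hdet (by simp [h]))
    ((V₂ p).2 • .fst ℂ ℂ ℂ - (V₂ p).1 • .snd ℂ ℂ ℂ) (by simp [mul_comm])
  obtain ⟨v, hv, hv', hvV⟩ := exists_firstIntegral h₁ (fun h => hdet (by simp [h]))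
    ((V₁ p).1 • .snd ℂ ℂ ℂ - (V₁ p).2 • .fst ℂ ℂ ℂ) (by simp [mul_comm])
  have hψ {y : ℂ × ℂ} (hy : AnalyticAt ℂ u y ∧ AnalyticAt ℂ v y) :
      HasFDerivAt (fun y => (u y, v y)) ((fderiv ℂ u y).prod (fderiv ℂ v y)) y :=
    hy.1.differentiableAt.hasFDerivAt.prodMk hy.2.differentiableAt.hasFDerivAt
  have hinj : Function.Injective ((fderiv ℂ u p).prod (fderiv ℂ v p)) := by
    refine (injective_iff_map_eq_zero _).2 fun a ha => ?_
    simp only [hu', hv', ContinuousLinearMap.prod_apply, sub_apply, smul_apply, smul_eq_mul,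
      ContinuousLinearMap.coe_fst', ContinuousLinearMap.coe_snd', Prod.mk_eq_zero] at ha
    refine Prod.ext ((mul_eq_zero.1 ?_).resolve_left hdet) ((mul_eq_zero.1 ?_).resolve_left hdet)
    · linear_combination (V₁ p).1 * ha.1 + (V₂ p).1 * ha.2
    · linear_combination (V₁ p).2 * ha.1 + (V₂ p).2 * ha.2
  obtain ⟨φ, hp, hφψ, hφ, hφ'⟩ := exists_contDiffOn_openPartialHomeomorph
    (n := ω) (f' := (LinearEquiv.ofInjectiveEndo _ hinj).toContinuousLinearEquiv)
    (hu.prod hv).contDiffAt (hψ ⟨hu, hv⟩) (by simp) (by simp)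
  refine ⟨φ, hp, hφ, hφ', (φ.eventually_nhds _ hp).2 ?_⟩
  filter_upwards [huV, hvV, hu.eventually_analyticAt, hv.eventually_analyticAt,
    φ.open_source.eventually_mem hp] with y hyu hyv hau hav hy
  have hinv (a : ℂ × ℂ) : fderiv ℂ φ.symm (φ y) (fderiv ℂ u y a, fderiv ℂ v y a) = a := by
    have hsymm := (hφ'.contDiffAt (φ.open_target.mem_nhds (φ.map_source hy))).differentiableAt
      (by simp)
    have hcomp := hsymm.hasFDerivAt.comp y (hφψ ▸ hψ ⟨hau, hav⟩)
    exact DFunLike.congr_fun (hcomp.unique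
      ((hasFDerivAt_id y).congr_of_eventuallyEq (φ.eventually_left_inverse hy))) a
  refine ⟨fderiv ℂ u y (V₁ y), fderiv ℂ v y (V₂ y), ?_, ?_⟩ <;> rw [φ.left_inv hy, ← map_smul]
  · simpa [show fderiv ℂ v y (V₁ y) = 0 from hyv] using (hinv (V₁ y)).symm
  · simpa [show fderiv ℂ u y (V₂ y) = 0 from hyu] using (hinv (V₂ y)).symm

lemma exists_analyticAt_sqrt {E : Type*} [NormedAddCommGroup E] [NormedSpace ℂ E] {d : E → ℂ}
    {p : E} (hd : AnalyticAt ℂ d p) (hp : d p ≠ 0) :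
    ∃ σ : E → ℂ, AnalyticAt ℂ σ p ∧ ∀ᶠ z in 𝓝 p, σ z ^ 2 = d z := by
  obtain ⟨s, hs⟩ := IsAlgClosed.exists_pow_nat_eq (d p) two_pos
  have hquot : AnalyticAt ℂ (fun z => d z / d p) p := hd.fun_div analyticAt_const hp
  refine ⟨fun z => s * exp (log (d z / d p) / 2), analyticAt_const.fun_mul (AnalyticAt.cexp'
    ((hquot.clog ?_).fun_div analyticAt_const two_ne_zero)), ?_⟩
  · simp [hp, one_mem_slitPlane]
  · filter_upwards [hd.continuousAt.eventually_ne hp] with z hz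
    rw [mul_pow, hs, ← exp_nat_mul, Nat.cast_two, mul_div_cancel₀ _ two_ne_zero,
      exp_log (div_ne_zero hz hp), mul_div_cancel₀ _ hp]

/-- The value of the quadratic form `E dz₁² + 2F dz₁dz₂ + G dz₂²` at the vector `a`. -/
def binaryForm (E F G : ℂ) (a : ℂ × ℂ) : ℂ := E * a.1 ^ 2 + 2 * F * a.1 * a.2 + G * a.2 ^ 2

lemma binaryForm_eq_zero_of_smul {E F G k : ℂ} {a : ℂ × ℂ} (hk : k • a ≠ 0)
    (h : binaryForm E F G (k • a) = 0) : binaryForm E F G a = 0 := by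
  have hk' : k ≠ 0 := fun h => hk (by simp [h])
  refine (mul_eq_zero.1 ?_).resolve_left (pow_ne_zero 2 hk')
  simp only [binaryForm, Prod.smul_fst, Prod.smul_snd, smul_eq_mul] at h ⊢
  linear_combination h

section

variable {E F G : ℂ × ℂ → ℂ} {p : ℂ × ℂ}

/-- The form is, up to the unit `D`, the product `(E z₁ + D z₂)(D z₁ + G z₂)`; here
`D = F ± √(F² - EG)`. -/
lemma exists_analyticAt_isotropic_root (hE : AnalyticAt ℂ E p) (hF : AnalyticAt ℂ F p)
    (hG : AnalyticAt ℂ G p) (hd : E p * G p - F p ^ 2 ≠ 0) :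
    ∃ D : ℂ × ℂ → ℂ, AnalyticAt ℂ D p ∧ D p ≠ 0 ∧ D p ^ 2 ≠ E p * G p ∧
      ∀ᶠ z in 𝓝 p, D z ^ 2 + E z * G z = 2 * F z * D z := by
  obtain ⟨σ, hσ, hσ₂⟩ := exists_analyticAt_sqrt ((hF.fun_pow 2).fun_sub (hE.fun_mul hG))
    (fun h => hd (by linear_combination -h))
  have hσp := hσ₂.self_of_nhds
  have hσ₀ : σ p ≠ 0 := fun h => hd (by linear_combination hσp - σ p * h)
  obtain ⟨ε, hε, hne⟩ : ∃ ε : ℂ, ε ^ 2 = 1 ∧ F p + ε * σ p ≠ 0 := by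
    by_contra! h
    exact hσ₀ (by linear_combination (h 1 (by norm_num) - h (-1) (by norm_num)) / 2)
  have hε₀ : ε ≠ 0 := by rintro rfl; norm_num at hε
  refine ⟨fun z => F z + ε * σ z, hF.fun_add (analyticAt_const.fun_mul hσ), hne, fun h => ?_, ?_⟩
  · refine mul_ne_zero (mul_ne_zero hε₀ hσ₀) hne ?_
    linear_combination (h + ε ^ 2 * hσp + (F p ^ 2 - E p * G p) * hε) / 2
  · filter_upwards [hσ₂] with z hz
    linear_combination ε ^ 2 * hz + (F z ^ 2 - E z * G z) * hε

theorem exists_null_coordinates (hE : AnalyticAt ℂ E p) (hF : AnalyticAt ℂ F p)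
    (hG : AnalyticAt ℂ G p) (hd : E p * G p - F p ^ 2 ≠ 0) :
    ∃ φ : OpenPartialHomeomorph (ℂ × ℂ) (ℂ × ℂ), p ∈ φ.source ∧
      ContDiffOn ℂ ω φ φ.source ∧ ContDiffOn ℂ ω φ.symm φ.target ∧
      ∀ᶠ z in 𝓝 (φ p), ∀ b ∈ ({(1, 0), (0, 1)} : Set (ℂ × ℂ)),
        binaryForm (E (φ.symm z)) (F (φ.symm z)) (G (φ.symm z)) (fderiv ℂ φ.symm z b) = 0 := by
  obtain ⟨D, hD, hDp, hDEG, hDeq⟩ := exists_analyticAt_isotropic_root hE hF hG hd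
  obtain ⟨φ, hp, hφ, hφ', hV⟩ := exists_coordinates_of_transversal
    (V₁ := fun z => (D z, -E z)) (V₂ := fun z => (-G z, D z)) (hD.prod hE.neg) (hG.neg.prod hD)
    (fun h => hDEG (by linear_combination h))
  refine ⟨φ, hp, hφ, hφ', ?_⟩
  have hφp : Filter.Tendsto φ.symm (𝓝 (φ p)) (𝓝 p) := φ.tendsto_symm hp
  filter_upwards [hV, hφp.eventually hDeq,
    hφp.eventually (hD.continuousAt.eventually_ne hDp)] with z ⟨k₁, k₂, h₁, h₂⟩ hDz hDz₀
  rintro b (rfl | rfl)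
  · refine binaryForm_eq_zero_of_smul (k := k₁) ?_ ?_ <;> rw [← h₁]
    · exact fun h => hDz₀ (congrArg Prod.fst h)
    · rw [binaryForm]
      linear_combination E (φ.symm z) * hDz
  · refine binaryForm_eq_zero_of_smul (k := k₂) ?_ ?_ <;> rw [← h₂]
    · exact fun h => hDz₀ (congrArg Prod.snd h)
    · rw [binaryForm]
      linear_combination G (φ.symm z) * hDz

end

/-! ### Differentials in charts -/

lemma eventually_mem_chart {X : Type*} [TopologicalSpace X]
    {e : OpenPartialHomeomorph X (ℂ × ℂ)} {z : ℂ × ℂ} {U : Set X} (hU : IsOpen U)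
    (hz : z ∈ e.target) (hzU : e.symm z ∈ U) : ∀ᶠ y in 𝓝 z, y ∈ e.target ∧ e.symm y ∈ U :=
  (e.open_target.eventually_mem hz).and
    ((e.symm.continuousAt hz).eventually (hU.mem_nhds hzU))

section

variable {X : Type*} [TopologicalSpace X] [ChartedSpace (ℂ × ℂ) X]
  {e : OpenPartialHomeomorph X (ℂ × ℂ)} {z : ℂ × ℂ} {U : Set X}

lemma HolChart.mdifferentiable (he : HolChart e) : e.MDifferentiable surfaceModel surfaceModel :=
  ⟨(contMDiffOn_of_mem_maximalAtlas he).mdifferentiableOn (by simp),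
    (contMDiffOn_symm_of_mem_maximalAtlas he).mdifferentiableOn (by simp)⟩

lemma HolChart.chartVec_surjective (he : HolChart e) (hz : z ∈ e.target) :
    Function.Surjective (chartVec e z) :=
  he.mdifferentiable.symm.mfderiv_surjective hz

lemma chartVec_add (e : OpenPartialHomeomorph X (ℂ × ℂ)) (z a b : ℂ × ℂ) :
    chartVec e z (a + b) = chartVec e z a + chartVec e z b :=
  map_add (mfderiv surfaceModel surfaceModel e.symm z) a b

lemma chartVec_smul (e : OpenPartialHomeomorph X (ℂ × ℂ)) (z a : ℂ × ℂ) (c : ℂ) :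
    chartVec e z (c • a) = c • chartVec e z a :=
  map_smul (mfderiv surfaceModel surfaceModel e.symm z) c a

lemma chartVec_eq (e : OpenPartialHomeomorph X (ℂ × ℂ)) (z a : ℂ × ℂ) :
    chartVec e z a = a.1 • chartVec e z (1, 0) + a.2 • chartVec e z (0, 1) := by
  rw [← chartVec_smul, ← chartVec_smul, ← chartVec_add]
  simp

lemma HolChart.chartVec_trans (he : HolChart e) {φ : OpenPartialHomeomorph (ℂ × ℂ) (ℂ × ℂ)}
    (hz : φ.symm z ∈ e.target) (hφ : DifferentiableAt ℂ φ.symm z) (a : ℂ × ℂ) :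
    chartVec (e.trans φ) z a = chartVec e (φ.symm z) (fderiv ℂ φ.symm z a) := by
  have hcomp := mfderiv_comp z (he.mdifferentiable.mdifferentiableAt_symm hz) hφ.mdifferentiableAt
  rw [mfderiv_eq_fderiv] at hcomp
  exact DFunLike.congr_fun hcomp a

variable {f : X → ℂ}

lemma HolFunOn.analyticAt (hf : HolFunOn f U) (hU : IsOpen U) (he : HolChart e)
    (hz : z ∈ e.target) (hzU : e.symm z ∈ U) : AnalyticAt ℂ (fun y => f (e.symm y)) z :=
  ((hf.contMDiffAt (hU.mem_nhds hzU)).comp z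
    (contMDiffAt_symm_of_mem_maximalAtlas he hz)).contDiffAt.analyticAt

lemma HolChart.holFunOn_comp (he : HolChart e) {g : ℂ × ℂ → ℂ} {V : Set (ℂ × ℂ)}
    (hg : AnalyticOnNhd ℂ g V) : HolFunOn (fun y => g (e y)) (e.source ∩ e ⁻¹' V) := fun y hy =>
  ((hg _ hy.2).contDiffAt.contMDiffAt.comp y
    (contMDiffAt_of_mem_maximalAtlas he hy.1)).contMDiffWithinAt

/-- The differential `df` as a field of covectors. -/
def differential (f : X → ℂ) : CovectorField X := fun y =>
  ContinuousLinearMap.toLinearMap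
    (mfderiv surfaceModel 𝓘(ℂ, ℂ) f y : TangentSpace surfaceModel y →L[ℂ] ℂ)

lemma differential_chartVec (hf : HolFunOn f U) (hU : IsOpen U) (he : HolChart e)
    (hz : z ∈ e.target) (hzU : e.symm z ∈ U) (a : ℂ × ℂ) :
    differential f (e.symm z) (chartVec e z a) = fderiv ℂ (fun y => f (e.symm y)) z a := by
  have hfz : MDifferentiableAt surfaceModel 𝓘(ℂ, ℂ) f (e.symm z) :=
    (hf.contMDiffAt (hU.mem_nhds hzU)).mdifferentiableAt (by simp)
  have hcomp := mfderiv_comp z hfz (he.mdifferentiable.mdifferentiableAt_symm hz)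
  rw [mfderiv_eq_fderiv] at hcomp
  exact (DFunLike.congr_fun hcomp a).symm

lemma coeff₁_differential (hf : HolFunOn f U) (hU : IsOpen U) (he : HolChart e)
    (hz : z ∈ e.target) (hzU : e.symm z ∈ U) :
    coeff₁ (differential f) e =ᶠ[𝓝 z] partial₁ fun y => f (e.symm y) :=
  (eventually_mem_chart hU hz hzU).mono fun _ hy =>
    differential_chartVec hf hU he hy.1 hy.2 (1, 0)

lemma coeff₂_differential (hf : HolFunOn f U) (hU : IsOpen U) (he : HolChart e)
    (hz : z ∈ e.target) (hzU : e.symm z ∈ U) :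
    coeff₂ (differential f) e =ᶠ[𝓝 z] partial₂ fun y => f (e.symm y) :=
  (eventually_mem_chart hU hz hzU).mono fun _ hy =>
    differential_chartVec hf hU he hy.1 hy.2 (0, 1)

lemma holFormOn_differential (hf : HolFunOn f U) (hU : IsOpen U) : HolFormOn (differential f) U :=
  fun _ he _ hz hzU =>
    have han := hf.analyticAt hU he hz hzU
    ⟨(analyticAt_partial₁ han).congr (coeff₁_differential hf hU he hz hzU).symm,
      (analyticAt_partial₂ han).congr (coeff₂_differential hf hU he hz hzU).symm⟩

lemma closedFormOn_differential (hf : HolFunOn f U) (hU : IsOpen U) :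
    ClosedFormOn (differential f) U := by
  intro e he z hz hzU
  rw [(partial₁_congr (coeff₂_differential hf hU he hz hzU)).eq_of_nhds,
    (partial₂_congr (coeff₁_differential hf hU he hz hzU)).eq_of_nhds,
    partial₁_partial₂ (hf.analyticAt hU he hz hzU)]

end

/-! ### Quadratic differentials in charts -/

lemma exists_mul_sub_mul_ne_zero {R M : Type*} [CommRing R] [Nontrivial R] [AddCommGroup M]
    [Module R M] {α β : Module.Dual R M} (h : LinearIndependent R ![α, β]) :
    ∃ a b, α a * β b - α b * β a ≠ 0 := by
  rw [LinearIndependent.pair_iff] at h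
  by_contra! hdet
  have hα : α = 0 := by
    ext a
    refine (h (-β a) (α a) ?_).2
    ext b
    simp only [LinearMap.add_apply, LinearMap.smul_apply, smul_eq_mul, LinearMap.zero_apply]
    linear_combination hdet a b
  exact one_ne_zero (h 1 0 (by simp [hα])).1

section

variable {X : Type*} [TopologicalSpace X] [ChartedSpace (ℂ × ℂ) X]
  {e : OpenPartialHomeomorph X (ℂ × ℂ)} {z : ℂ × ℂ} {U : Set X}

lemma apply_chartVec (q : QuadraticField X) (e : OpenPartialHomeomorph X (ℂ × ℂ)) (z a : ℂ × ℂ) :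
    q (e.symm z) (chartVec e z a) = binaryForm (coeffE q e z) (coeffF q e z) (coeffG q e z) a := by
  rw [chartVec_eq, QuadraticMap.map_add (q (e.symm z)), QuadraticMap.map_smul,
    QuadraticMap.map_smul, QuadraticMap.polar_smul_left, QuadraticMap.polar_smul_right]
  simp only [binaryForm, coeffE, coeffF, coeffG, smul_eq_mul]
  ring

/-- Nondegeneracy of the quadratic form `q x` on the tangent plane at `x`, phrased without charts
as the nonvanishing of the Gram determinant of some pair of tangent vectors. -/
def NondegenerateAt (q : QuadraticField X) (x : X) : Prop :=
  ∃ a b : TangentSpace surfaceModel x,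
    q x a * q x b - (QuadraticMap.polar (q x) a b / 2) ^ 2 ≠ 0

lemma HolChart.discr_ne_zero_iff (he : HolChart e) (q : QuadraticField X) (hz : z ∈ e.target) :
    discr q e z ≠ 0 ↔ NondegenerateAt q (e.symm z) := by
  refine ⟨fun h => ⟨_, _, h⟩, ?_⟩
  rintro ⟨s, t, hst⟩ h
  obtain ⟨a, rfl⟩ := he.chartVec_surjective hz s
  obtain ⟨b, rfl⟩ := he.chartVec_surjective hz t
  apply hst
  rw [QuadraticMap.polar, ← chartVec_add, apply_chartVec, apply_chartVec, apply_chartVec]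
  rw [discr] at h
  simp only [binaryForm, Prod.fst_add, Prod.snd_add]
  linear_combination (a.1 * b.2 - a.2 * b.1) ^ 2 * h

lemma HolChart.discr_apply_ne_zero_iff (he : HolChart e) (q : QuadraticField X) {x : X}
    (hx : x ∈ e.source) : discr q e (e x) ≠ 0 ↔ NondegenerateAt q x := by
  rw [he.discr_ne_zero_iff q (e.map_source hx), e.left_inv hx]

lemma HolQuadOn.analyticAt_discr {q : QuadraticField X} (hq : HolQuadOn q U) (he : HolChart e)
    (hz : z ∈ e.target) (hzU : e.symm z ∈ U) : AnalyticAt ℂ (discr q e) z := by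
  obtain ⟨hE, hF, hG⟩ := hq e he z hz hzU
  exact (hE.fun_mul hG).fun_sub (hF.fun_pow 2)

lemma discr_of_eq_mul {w q : QuadraticField X} {c : ℂ}
    (h : ∀ v, w (e.symm z) v = c * q (e.symm z) v) : discr w e z = discr q e z * c ^ 2 := by
  simp only [discr, coeffE, coeffF, coeffG, QuadraticMap.polar, h]
  ring

lemma nondegenerateAt_of_linearIndependent {q : QuadraticField X} {x : X}
    {α β : Module.Dual ℂ (TangentSpace surfaceModel x)} (hαβ : LinearIndependent ℂ ![α, β])
    (hq : ∀ v, q x v = α v * β v) : NondegenerateAt q x := by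
  obtain ⟨a, b, hab⟩ := exists_mul_sub_mul_ne_zero hαβ
  refine ⟨a, b, fun h => hab (pow_eq_zero_iff two_ne_zero |>.1 ?_)⟩
  simp only [QuadraticMap.polar, hq, map_add] at h
  linear_combination -4 * h

lemma HasRankTwo.degenerate_ne_univ {w : SymmetricTwoDifferential X} (hw : HasRankTwo w) :
    {x | ¬ NondegenerateAt w.toField x} ≠ Set.univ := by
  obtain ⟨Z, -, hZ, h⟩ := hw
  obtain ⟨x, hx⟩ := (Set.ne_univ_iff_exists_notMem Z).1 hZ
  obtain ⟨α, β, hαβ, hq⟩ := h x hx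
  exact (Set.ne_univ_iff_exists_notMem _).2
    ⟨x, not_not_intro (nondegenerateAt_of_linearIndependent hαβ hq)⟩

end

/-! ### Closed decompositions -/

section

variable {X : Type*} [TopologicalSpace X] [ChartedSpace (ℂ × ℂ) X]
  {w : SymmetricTwoDifferential X} {e : OpenPartialHomeomorph X (ℂ × ℂ)} {x : X}

theorem HasClosedDecompositionAt.complexCurvature_eq_zero {z : ℂ × ℂ} (he : HolChart e)
    (hz : z ∈ e.target) (h : HasClosedDecompositionAt w (e.symm z)) :
    complexCurvature w e z = 0 := by
  obtain ⟨U, hU, hzU, μ, ν, hμ, hμ', hν, hν', hw⟩ := h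
  have hev := eventually_mem_chart hU hz hzU
  obtain ⟨hμ₁, hμ₂⟩ := hμ e he z hz hzU
  obtain ⟨hν₁, hν₂⟩ := hν e he z hz hzU
  refine (brioschi_congr ?_ ?_ ?_).trans (brioschi_mul_of_closed hμ₁ hμ₂ hν₁ hν₂
    (hev.mono fun y hy => hμ' e he y hy.1 hy.2) (hev.mono fun y hy => hν' e he y hy.1 hy.2))
  · exact hev.mono fun y hy => hw _ hy.2 _
  · filter_upwards [hev] with y hy
    simp only [coeffF, QuadraticMap.polar, hw _ hy.2, map_add, coeff₁, coeff₂, Pi.mul_apply]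
    ring
  · exact hev.mono fun y hy => hw _ hy.2 _

lemma hasClosedDecompositionAt_of_fderiv (he : HolChart e) (hx : x ∈ e.source)
    {V : Set (ℂ × ℂ)} (hV : IsOpen V) (hxV : e x ∈ V) (hVe : V ⊆ e.target) {a b : ℂ × ℂ → ℂ}
    (ha : AnalyticOnNhd ℂ a V) (hb : AnalyticOnNhd ℂ b V)
    (h : ∀ z ∈ V, ∀ t, binaryForm (coeffE w.toField e z) (coeffF w.toField e z)
      (coeffG w.toField e z) t = fderiv ℂ a z t * fderiv ℂ b z t) :
    HasClosedDecompositionAt w x := by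
  have hU : IsOpen (e.source ∩ e ⁻¹' V) := e.isOpen_inter_preimage hV
  have ha' := he.holFunOn_comp ha
  have hb' := he.holFunOn_comp hb
  refine ⟨_, hU, ⟨hx, hxV⟩, differential fun y => a (e y), differential fun y => b (e y),
    holFormOn_differential ha' hU, closedFormOn_differential ha' hU,
    holFormOn_differential hb' hU, closedFormOn_differential hb' hU, fun y hy v => ?_⟩
  obtain ⟨z, hzV, rfl⟩ : ∃ z ∈ V, e.symm z = y := ⟨e y, hy.2, e.left_inv hy.1⟩
  have hz := hVe hzV
  obtain ⟨t, rfl⟩ := he.chartVec_surjective hz v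
  have hcomp (g : ℂ × ℂ → ℂ) : (fun y => g (e (e.symm y))) =ᶠ[𝓝 z] g :=
    (e.open_target.eventually_mem hz).mono fun y hy => congrArg g (e.right_inv hy)
  rw [apply_chartVec, h z hzV, differential_chartVec ha' hU he hz hy,
    differential_chartVec hb' hU he hz hy, (hcomp a).fderiv_eq, (hcomp b).fderiv_eq]

lemma exists_hasFDerivAt_fst_snd {A B : ℂ → ℂ} {p : ℂ × ℂ} {r : ℝ}
    (hA : DifferentiableOn ℂ A (ball p.1 r)) (hB : DifferentiableOn ℂ B (ball p.2 r)) :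
    ∃ a b : ℂ × ℂ → ℂ, AnalyticOnNhd ℂ a (ball p r) ∧ AnalyticOnNhd ℂ b (ball p r) ∧
      ∀ z ∈ ball p r, HasFDerivAt a (A z.1 • ContinuousLinearMap.fst ℂ ℂ ℂ) z ∧
        HasFDerivAt b (B z.2 • ContinuousLinearMap.snd ℂ ℂ ℂ) z := by
  obtain ⟨a, ha⟩ := hA.isExactOn_ball
  obtain ⟨b, hb⟩ := hB.isExactOn_ball
  have ha' : DifferentiableOn ℂ a (ball p.1 r) := fun t ht =>
    (ha t ht).differentiableAt.differentiableWithinAt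
  have hb' : DifferentiableOn ℂ b (ball p.2 r) := fun t ht =>
    (hb t ht).differentiableAt.differentiableWithinAt
  rw [← ball_prod_same]
  refine ⟨fun z => a z.1, fun z => b z.2,
    fun z hz => (ha'.analyticAt (isOpen_ball.mem_nhds hz.1)).comp analyticAt_fst,
    fun z hz => (hb'.analyticAt (isOpen_ball.mem_nhds hz.2)).comp analyticAt_snd, fun z hz => ?_⟩
  exact ⟨(ha z.1 hz.1).comp_hasFDerivAt z hasFDerivAt_fst,
    (hb z.2 hz.2).comp_hasFDerivAt z hasFDerivAt_snd⟩

end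

section

variable {X : Type*} [TopologicalSpace X] [ChartedSpace (ℂ × ℂ) X]
  {w : SymmetricTwoDifferential X} {e : OpenPartialHomeomorph X (ℂ × ℂ)} {x : X}

lemma hasClosedDecompositionAt_of_separated (he : HolChart e) (hx : x ∈ e.source) {r : ℝ}
    (hr : 0 < r) (hB : ball (e x) r ⊆ e.target)
    (hE : ∀ z ∈ ball (e x) r, coeffE w.toField e z = 0)
    (hG : ∀ z ∈ ball (e x) r, coeffG w.toField e z = 0) {A B : ℂ → ℂ}
    (hA : DifferentiableOn ℂ A (ball (e x).1 r)) (hB' : DifferentiableOn ℂ B (ball (e x).2 r))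
    (hF : ∀ z ∈ ball (e x) r, coeffF w.toField e z = A z.1 * B z.2) :
    HasClosedDecompositionAt w x := by
  obtain ⟨a, b, haan, hban, hab⟩ := exists_hasFDerivAt_fst_snd (hA.const_mul 2) hB'
  refine hasClosedDecompositionAt_of_fderiv he hx isOpen_ball (mem_ball_self hr) hB haan hban
    fun z hz t => ?_
  obtain ⟨ha, hb⟩ := hab z hz
  rw [ha.fderiv, hb.fderiv, binaryForm, hE z hz, hF z hz, hG z hz]
  simp only [_root_.smul_apply, ContinuousLinearMap.coe_fst',
    ContinuousLinearMap.coe_snd', smul_eq_mul]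
  ring

lemma continuousAt_complexCurvature (w : SymmetricTwoDifferential X) (he : HolChart e)
    {z : ℂ × ℂ} (hz : z ∈ e.target) (hd : discr w.toField e z ≠ 0) :
    ContinuousAt (complexCurvature w e) z :=
  have ⟨hE, hF, hG⟩ := w.holomorphic e he z hz (Set.mem_univ _)
  continuousAt_brioschi hE hF hG hd

lemma ComplexCurvatureVanishes.hasClosedDecompositionAt_of_null (hK : ComplexCurvatureVanishes w)
    (he : HolChart e) (hx : x ∈ e.source)
    (hnull : ∀ᶠ z in 𝓝 (e x), coeffE w.toField e z = 0 ∧ coeffG w.toField e z = 0) :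
    HasClosedDecompositionAt w x := by
  obtain ⟨r, hr, hball⟩ := eventually_nhds_iff_ball.1
    ((e.open_target.eventually_mem (e.map_source hx)).and hnull)
  have hF : AnalyticOnNhd ℂ (coeffF w.toField e) (ball (e x) r) := fun z hz =>
    (w.holomorphic e he z (hball z hz).1 (Set.mem_univ _)).2.1
  have hFpartial : ∀ z ∈ ball (e x) r, coeffF w.toField e z ≠ 0 →
      partial₂ (partial₁ (coeffF w.toField e)) z * coeffF w.toField e z =
        partial₁ (coeffF w.toField e) z * partial₂ (coeffF w.toField e) z := by
    intro z hz hFz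
    have hev := isOpen_ball.eventually_mem hz
    have hd : discr w.toField e z ≠ 0 := by simp [discr, (hball z hz).2, hFz]
    have hcurv := hK e he z (hball z hz).1 hd
    rw [complexCurvature, brioschi_congr (E' := 0) (G' := 0)
      (hev.mono fun y hy => (hball y hy).2.1) .rfl (hev.mono fun y hy => (hball y hy).2.2),
      brioschi_zero_zero, div_eq_zero_iff, or_iff_left (pow_ne_zero 3 hFz)] at hcurv
    linear_combination -hcurv
  obtain ⟨A, B, hA, hB, hAB⟩ := exists_eq_mul_of_partial hF hFpartial
  exact hasClosedDecompositionAt_of_separated he hx hr (fun z hz => (hball z hz).1)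
    (fun z hz => (hball z hz).2.1) (fun z hz => (hball z hz).2.2) hA hB hAB

end

/-! ### Null charts and the core discriminant -/

section

variable {X : Type*} [TopologicalSpace X] [ChartedSpace (ℂ × ℂ) X]
  {w : SymmetricTwoDifferential X} {e : OpenPartialHomeomorph X (ℂ × ℂ)} {x : X}

lemma exists_nondegenerate_factor (hx : x ∉ coreDiscrSupport w) :
    (∀ᶠ y in 𝓝 x, w.toField y = 0) ∨ ∃ (h : X → ℂ) (q : QuadraticField X) (U : Set X),
      IsOpen U ∧ x ∈ U ∧ HolQuadOn q U ∧ (∀ y ∈ U, ∀ v, w.toField y v = h y * q y v) ∧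
        NondegenerateAt q x := by
  simp only [coreDiscrSupport, Set.mem_ofPred_eq, not_forall] at hx
  obtain ⟨δ, ⟨hδ, h, ⟨⟨U, hU, hxU, -, q, hq, hwq⟩, -⟩, e, he, hxe, hdisc⟩, hδx⟩ := hx
  have hex := e.map_source hxe
  rcases eq_or_ne (discr q e (e x)) (δ x) with hqδ | hqδ
  · exact .inr ⟨h, q, U, hU, hxU, hq, hwq, (he.discr_apply_ne_zero_iff q hxe).1 (hqδ ▸ hδx)⟩
  -- The two factorizations `discr q * h² = discr w = δ * h²` force `h = 0` near `x`.
  have hcont : ContinuousAt (fun y => discr q e (e y)) x :=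
    (hq.analyticAt_discr he hex (by rwa [e.left_inv hxe])).continuousAt.comp
      (e.continuousAt hxe)
  left
  filter_upwards [(hcont.ne_iff_eventually_ne hδ.continuousAt).1 hqδ, hU.eventually_mem hxU,
    e.open_source.eventually_mem hxe, hdisc] with y hy hyU hye hyd
  rw [discr_of_eq_mul (q := q) (c := h y) (by rw [e.left_inv hye]; exact hwq y hyU)] at hyd
  have hh : h y = 0 := by
    by_contra hh
    exact hy (mul_right_cancel₀ (pow_ne_zero 2 hh) hyd)
  ext v
  simp [hwq y hyU, hh]

lemma isZeroDivisorEquation_one (h : NondegenerateAt w.toField x) :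
    IsZeroDivisorEquation w x 1 := by
  refine ⟨⟨Set.univ, isOpen_univ, Set.mem_univ _, contMDiffOn_const, w.toField, w.holomorphic,
    fun y _ v => (one_mul _).symm⟩, ?_⟩
  rintro h' ⟨U, hU, hxU, hh', q, -, hwq⟩
  have hne : h' x ≠ 0 := by
    intro h0
    obtain ⟨a, b, hab⟩ := h
    simp [QuadraticMap.polar, hwq x hxU, h0] at hab
  have hh'x : ContMDiffAt surfaceModel 𝓘(ℂ, ℂ) ω h' x := hh'.contMDiffAt (hU.mem_nhds hxU)
  refine ⟨fun y => (h' y)⁻¹, (contDiffAt_inv ℂ hne).contMDiffAt.comp x hh'x, ?_⟩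
  filter_upwards [hh'x.continuousAt.eventually_ne hne] with y hy
  exact (inv_mul_cancel₀ hy).symm

variable [IsManifold surfaceModel ω X]

lemma holChart_chartAt (x : X) : HolChart (chartAt (ℂ × ℂ) x) :=
  IsManifold.chart_mem_maximalAtlas x

lemma HolChart.trans (he : HolChart e) {φ : OpenPartialHomeomorph (ℂ × ℂ) (ℂ × ℂ)}
    (hφ : ContDiffOn ℂ ω φ φ.source) (hφ' : ContDiffOn ℂ ω φ.symm φ.target) :
    HolChart (e.trans φ) := by
  refine (e.trans φ).mem_maximalAtlas_of_contMDiffOn ?_ ?_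
  · rw [e.trans_source]
    exact hφ.contMDiffOn.comp' (contMDiffOn_of_mem_maximalAtlas he)
  · rw [e.trans_target]
    exact (contMDiffOn_symm_of_mem_maximalAtlas he).comp' hφ'.contMDiffOn

lemma NondegenerateAt.exists_nullChart {q : QuadraticField X} {U : Set X} (hq : HolQuadOn q U)
    (hxU : x ∈ U) (h : NondegenerateAt q x) :
    ∃ e : OpenPartialHomeomorph X (ℂ × ℂ), HolChart e ∧ x ∈ e.source ∧
      ∀ᶠ z in 𝓝 (e x), coeffE q e z = 0 ∧ coeffG q e z = 0 := by
  set e := chartAt (ℂ × ℂ) x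
  have he : HolChart e := holChart_chartAt x
  have hxe : x ∈ e.source := mem_chart_source _ x
  obtain ⟨hE, hF, hG⟩ := hq e he (e x) (e.map_source hxe) (by rwa [e.left_inv hxe])
  obtain ⟨φ, hpφ, hφ, hφ', hnull⟩ := exists_null_coordinates hE hF hG
    ((he.discr_apply_ne_zero_iff q hxe).2 h)
  have hxs : x ∈ (e.trans φ).source := by simpa [e.trans_source] using ⟨hxe, hpφ⟩
  refine ⟨e.trans φ, he.trans hφ hφ', hxs, ?_⟩
  have htarget := (e.trans φ).open_target.eventually_mem ((e.trans φ).map_source hxs)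
  filter_upwards [hnull, htarget] with z hz hzt
  rw [e.trans_target] at hzt
  have hφz := ((hφ' z hzt.1).contDiffAt (φ.open_target.mem_nhds hzt.1)).differentiableAt (by simp)
  have key : ∀ b ∈ ({(1, 0), (0, 1)} : Set (ℂ × ℂ)),
      q ((e.trans φ).symm z) (chartVec (e.trans φ) z b) = 0 := fun b hb => by
    rw [he.chartVec_trans hzt.2 hφz]
    exact (apply_chartVec q e _ _).trans (hz b hb)
  exact ⟨key _ (by simp), key _ (by simp)⟩

lemma exists_nullChart (hx : x ∉ coreDiscrSupport w) :
    ∃ e : OpenPartialHomeomorph X (ℂ × ℂ), HolChart e ∧ x ∈ e.source ∧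
      ∀ᶠ z in 𝓝 (e x), coeffE w.toField e z = 0 ∧ coeffG w.toField e z = 0 := by
  have tendsto_symm {e : OpenPartialHomeomorph X (ℂ × ℂ)} (hxe : x ∈ e.source) :
      Filter.Tendsto e.symm (𝓝 (e x)) (𝓝 x) := by
    simpa only [ContinuousAt, e.left_inv hxe] using e.symm.continuousAt (e.map_source hxe)
  rcases exists_nondegenerate_factor hx with hw | ⟨h, q, U, hU, hxU, hq, hwq, hnd⟩
  · refine ⟨_, holChart_chartAt x, mem_chart_source _ x, ?_⟩
    filter_upwards [(tendsto_symm (mem_chart_source _ x)).eventually hw] with z hz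
    simp [coeffE, coeffG, hz]
  · obtain ⟨e, he, hxe, hnull⟩ := hnd.exists_nullChart hq hxU
    refine ⟨e, he, hxe, ?_⟩
    filter_upwards [hnull, (tendsto_symm hxe).eventually (hU.mem_nhds hxU)] with z hz hzU
    exact ⟨(hwq _ hzU _).trans (mul_eq_zero_of_right _ hz.1),
      (hwq _ hzU _).trans (mul_eq_zero_of_right _ hz.2)⟩

lemma NondegenerateAt.notMem_coreDiscrSupport (h : NondegenerateAt w.toField x) :
    x ∉ coreDiscrSupport w := by
  intro hx
  set e := chartAt (ℂ × ℂ) x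
  have he : HolChart e := holChart_chartAt x
  have hxe : x ∈ e.source := mem_chart_source _ x
  have hdiscr : AnalyticOnNhd ℂ (discr w.toField e) e.target := fun z hz =>
    w.holomorphic.analyticAt_discr he hz (Set.mem_univ _)
  refine (he.discr_apply_ne_zero_iff w.toField hxe).2 h
    (hx (fun y => discr w.toField e (e y)) ⟨?_, 1, isZeroDivisorEquation_one h, e, he, hxe, ?_⟩)
  · exact (he.holFunOn_comp hdiscr).contMDiffAt
      ((e.isOpen_inter_preimage e.open_target).mem_nhds ⟨hxe, e.map_source hxe⟩)
  · exact .of_forall fun y => by simp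

theorem complexCurvatureVanishes_iff_isFirstKindOn (w : SymmetricTwoDifferential X) :
    ComplexCurvatureVanishes w ↔ IsFirstKindOn w (coreDiscrSupport w)ᶜ := by
  refine ⟨fun hK x hx => ?_, fun h e he z hz hd => ?_⟩
  · obtain ⟨e, he, hxe, hnull⟩ := exists_nullChart hx
    exact hK.hasClosedDecompositionAt_of_null he hxe hnull
  · have hnd := (he.discr_ne_zero_iff w.toField hz).1 hd
    exact (h _ hnd.notMem_coreDiscrSupport).complexCurvature_eq_zero he hz

end

/-! ### Analytic subsets -/

section

variable {X : Type*} [TopologicalSpace X] [ChartedSpace (ℂ × ℂ) X] [IsManifold surfaceModel ω X]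
  {U : Set X} {x : X}

lemma exists_isOpen_forall_eq_zero (hU : IsOpen U) (hxU : x ∈ U) :
    ∃ V ⊆ U, IsOpen V ∧ x ∈ V ∧ ∀ f : X → ℂ, HolFunOn f U → ∀ y ∈ V,
      (∀ᶠ t in 𝓝 y, f t = 0) → ∀ t ∈ V, f t = 0 := by
  set e := chartAt (ℂ × ℂ) x
  have he : HolChart e := holChart_chartAt x
  have hxe : x ∈ e.source := mem_chart_source _ x
  obtain ⟨r, hr, hB⟩ := eventually_nhds_iff_ball.1
    (eventually_mem_chart hU (e.map_source hxe) (by rwa [e.left_inv hxe]))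
  refine ⟨e.source ∩ e ⁻¹' ball (e x) r, fun y hy => by simpa [e.left_inv hy.1] using (hB _ hy.2).2,
    e.isOpen_inter_preimage isOpen_ball, ⟨hxe, mem_ball_self hr⟩, fun f hf y hy hfy t ht => ?_⟩
  have han : AnalyticOnNhd ℂ (fun z => f (e.symm z)) (ball (e x) r) := fun z hz =>
    hf.analyticAt hU he (hB z hz).1 (hB z hz).2
  have hev : (fun z => f (e.symm z)) =ᶠ[𝓝 (e y)] 0 :=
    (e.symm.continuousAt (e.map_source hy.1)).tendsto.eventually (p := fun t => f t = 0)
      (by rwa [e.left_inv hy.1])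
  simpa [e.left_inv ht.1] using han.eqOn_zero_of_preconnected_of_eventuallyEq_zero
    (convex_ball _ _).isPreconnected hy.2 hev ht.2

theorem IsAnalyticSubset.dense_compl [ConnectedSpace X] {Z : Set X} (hZ : IsAnalyticSubset Z)
    (hne : Z ≠ Set.univ) : Dense Zᶜ := by
  have hclosed : IsClosed (interior Z) := by
    refine isClosed_of_closure_subset fun x hx => ?_
    obtain ⟨U, hU, hxU, n, f, hf, hfZ⟩ := hZ x
    obtain ⟨V, hVU, hV, hxV, hV0⟩ := exists_isOpen_forall_eq_zero hU hxU
    obtain ⟨y, hyV, hyZ⟩ := mem_closure_iff.1 hx V hV hxV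
    refine mem_interior.2 ⟨V, fun t ht => (hfZ t (hVU ht)).2 fun i => ?_, hV, hxV⟩
    refine hV0 (f i) (hf i) y hyV ?_ t ht
    filter_upwards [isOpen_interior.mem_nhds hyZ, hV.mem_nhds hyV] with s hsZ hsV
    exact (hfZ s (hVU hsV)).1 (interior_subset hsZ) i
  rw [← interior_eq_empty_iff_dense_compl]
  exact (isClopen_iff.1 ⟨hclosed, isOpen_interior⟩).resolve_right (mt interior_eq_univ.1 hne)

lemma isAnalyticSubset_degenerate (w : SymmetricTwoDifferential X) :
    IsAnalyticSubset {x | ¬ NondegenerateAt w.toField x} := by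
  intro x
  set e := chartAt (ℂ × ℂ) x
  have he : HolChart e := holChart_chartAt x
  have hdiscr : AnalyticOnNhd ℂ (discr w.toField e) e.target := fun z hz =>
    w.holomorphic.analyticAt_discr he hz (Set.mem_univ _)
  refine ⟨e.source, e.open_source, mem_chart_source _ x, 1, fun _ y => discr w.toField e (e y),
    fun _ => (he.holFunOn_comp hdiscr).mono fun y hy => ⟨hy, e.map_source hy⟩, fun y hy => ?_⟩
  rw [Set.mem_ofPred_eq, ← he.discr_apply_ne_zero_iff w.toField hy, not_not, forall_const]

variable [ConnectedSpace X] {w : SymmetricTwoDifferential X}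

theorem IsClosedDifferential.complexCurvatureVanishes (h : IsClosedDifferential w) :
    ComplexCurvatureVanishes w := by
  obtain ⟨Z, hZ, hne, hdec⟩ := h
  intro e he z hz hd
  have hfreq : ∃ᶠ y in 𝓝 z, e.symm y ∈ Zᶜ :=
    mt (e.symm.eventually_nhds (· ∉ Zᶜ) hz).2
      (mem_closure_iff_frequently.1 (hZ.dense_compl hne _))
  refine tendsto_nhds_unique_of_frequently_eq (continuousAt_complexCurvature w he hz hd)
    tendsto_const_nhds
    ((hfreq.and_eventually (e.open_target.eventually_mem hz)).mono fun y hy => ?_)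
  exact (hdec _ hy.1).complexCurvature_eq_zero he hy.2

theorem isClosedDifferential_iff_complexCurvatureVanishes (hw : HasRankTwo w) :
    IsClosedDifferential w ↔ ComplexCurvatureVanishes w := by
  refine ⟨IsClosedDifferential.complexCurvatureVanishes, fun hK =>
    ⟨_, isAnalyticSubset_degenerate w, hw.degenerate_ne_univ, fun x hx => ?_⟩⟩
  exact (complexCurvatureVanishes_iff_isFirstKindOn w).1 hK x
    (not_not.1 hx).notMem_coreDiscrSupport

end

end ClosedDiff

end

open ClosedDiff in
theorem proposition2p1_general {X : Type*} [TopologicalSpace X] [ConnectedSpace X]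
    [ChartedSpace (ℂ × ℂ) X] [IsManifold surfaceModel ω X]
    (w : SymmetricTwoDifferential X) (hw : HasRankTwo w) :
    (IsClosedDifferential w ↔ ComplexCurvatureVanishes w) ∧
    (ComplexCurvatureVanishes w ↔ IsFirstKindOn w (coreDiscrSupport w)ᶜ) :=
  ⟨isClosedDifferential_iff_complexCurvatureVanishes hw,
    complexCurvatureVanishes_iff_isFirstKindOn w⟩

theorem proposition2p1 {X : Type*} [TopologicalSpace X] [T2Space X] [ConnectedSpace X]
    [ChartedSpace (ℂ × ℂ) X] [IsManifold ClosedDiff.surfaceModel ω X]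
    (w : ClosedDiff.SymmetricTwoDifferential X) (hw : ClosedDiff.HasRankTwo w) :
    (ClosedDiff.IsClosedDifferential w ↔ ClosedDiff.ComplexCurvatureVanishes w) ∧
    (ClosedDiff.ComplexCurvatureVanishes w ↔
      ClosedDiff.IsFirstKindOn w (ClosedDiff.coreDiscrSupport w)ᶜ) :=
  proposition2p1_general w hw
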